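/- Let $n\ge 1$ and let $a,b,c,d,q,t$ be nonzero complex numbers with $|q|<1$, $t^k\neq 1$ for $1\le k\le n$, and $abcd\,t^k\neq 1$ for all integers $-2\le k\le 2n-2$. For an integer $N\ge 0$, let $W_N=\mathbb Z_2^N\rtimes\mathfrak S_N$ act on $\mathbb Z^N$ by permutations and sign changes of the coordinates. A partition is here a tuple of integers $\lambda=(\lambda_1\ge\dots\ge\lambda_N\ge0)$, and $m_\lambda=\sum_{\mu\in W_N\lambda}x_1^{\mu_1}\cdots x_N^{\mu_N}$ denotes its orbit sum (each monomial of the orbit once). Write $\mu\le\lambda$ if $\mu_1+\dots+\mu_k\le\lambda_1+\dots+\lambda_k$ for all $1\le k\le N$. Put $\alpha=(abcd/q)^{1/2}$, $\langle x;y\rangle=x+x^{-1}-y-y^{-1}$, and $$\mathcal D_x=\sum_{i=1}^N\sum_{\epsilon=\pm1}\frac{(1-ax_i^{\epsilon})(1-bx_i^{\epsilon})(1-cx_i^{\epsilon})(1-dx_i^{\epsilon})}{\alpha t^{N-1}(1-x_i^{2\epsilon})(1-qx_i^{2\epsilon})}\prod_{j\ne i}\frac{(1-tx_i^{\epsilon}x_j)(1-tx_i^{\epsilon}/x_j)}{(1-x_i^{\epsilon}x_j)(1-x_i^{\epsilon}/x_j)}\bigl(T_{q,x_i}^{\epsilon}-1\bigr),$$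 where $T_{q,x_i}^{\pm1}$ replaces $x_i$ by $q^{\pm1}x_i$. The $BC_N$ Koornwinder polynomial $P^{BC_N}_\lambda=P_\lambda(x_1,\dots,x_N|a,b,c,d|q,t)$ is the Laurent polynomial characterized by (a) $P_\lambda-m_\lambda$ is a linear combination of the $m_\mu$ with $\mu$ a partition, $\mu\le\lambda$, $\mu\neq\lambda$; (b) $\mathcal D_xP_\lambda=d_\lambda P_\lambda$ with $d_\lambda=\sum_{j=1}^N\langle\alpha t^{N-j}q^{\lambda_j};\alpha t^{N-j}\rangle$. Let $(1^r)=(1,\dots,1,0,\dots,0)$ with $r$ ones, and set $P^{BC_N}_{(1^r)}=0$ for integers $r<0$ and $r>N$. Put $$f(s)=\frac{(1-abcds/t)(1-ts)(1-abs)(1-acs)(1-ads)(1-bcs)(1-bds)(1-cds)}{(1-abcds^2/t)(1-abcds^2)^2(1-abcdts^2)},$$ $$g_1(s)=\frac{a+b+c+d-(abc+abd+acd+bcd)s/t}{1-abcds^2/t^2}\cdot\frac{1-s}{1-t},\qquad g(s)=g_1(s)-g_1(st).$$ Then for $0\le r\le N\le n$ there is exactly one Laurent polynomial satisfying (a) and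 (b) for $\lambda=(1^r)$, and for every $0\le r\le n$ $$P^{BC_n}_{(1^r)}(x_1,\dots,x_n)=P^{BC_{n-1}}_{(1^r)}(x_1,\dots,x_{n-1})+\bigl(x_n+1/x_n+g(t^{n-r})\bigr)P^{BC_{n-1}}_{(1^{r-1})}(x_1,\dots,x_{n-1})+f(t^{n-r})\,P^{BC_{n-1}}_{(1^{r-2})}(x_1,\dots,x_{n-1}).$$ -/

import Mathlib

namespace Koornwinder

/-- Laurent polynomials over `ℂ` in `n` variables: the group algebra of `ℤⁿ`; the basis element
`single μ 1` is the monomial `x₁^{μ₁} ⋯ xₙ^{μₙ}`. -/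
abbrev Laurent (n : ℕ) : Type := AddMonoidAlgebra ℂ (Fin n → ℤ)

/-- The value of a Laurent polynomial at a point `x` (used at points with nonzero coordinates,
where a Laurent polynomial is determined by its values). -/
noncomputable def Laurent.eval {n : ℕ} (P : Laurent n) (x : Fin n → ℂ) : ℂ :=
  P.coeff.sum fun μ c => c * ∏ i, x i ^ μ i

/-- The `W_n`-orbit of an exponent `lam` under permutations and sign changes of the
coordinates. -/
def signedOrbit {n : ℕ} (lam : Fin n → ℕ) : Finset (Fin n → ℤ) :=
  (Finset.univ : Finset ((Fin n → ℤˣ) × Equiv.Perm (Fin n))).image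
    fun w i => ((w.1 i : ℤˣ) : ℤ) * (lam (w.2 i) : ℤ)

/-- The monomial symmetric polynomial `m_λ` of type `BC_n`: the orbit sum in which every monomial
of the `W_n`-orbit of `x^λ` occurs exactly once. -/
noncomputable def monomialSymm {n : ℕ} (lam : Fin n → ℕ) : Laurent n :=
  ∑ μ ∈ signedOrbit lam, AddMonoidAlgebra.single μ (1 : ℂ)

/-- The dominance ordering `μ ≤ lam`: every partial sum `μ₁ + ⋯ + μ_k` is at most
`lam₁ + ⋯ + lam_k`. -/
def DominanceLE {n : ℕ} (μ lam : Fin n → ℕ) : Prop :=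
  ∀ k : Fin n, ∑ i ∈ Finset.Iic k, μ i ≤ ∑ i ∈ Finset.Iic k, lam i

/-- `α = (abcd/q)^{1/2}`. -/
noncomputable def alpha (a b c d q : ℂ) : ℂ := (a * b * c * d / q) ^ (1 / 2 : ℂ)

/-- The points at which no denominator of the Koornwinder operator vanishes. -/
def IsRegularPoint {n : ℕ} (q : ℂ) (x : Fin n → ℂ) : Prop :=
  (∀ i, x i ≠ 0 ∧ x i ^ 2 ≠ 1 ∧ q * x i ^ 2 ≠ 1 ∧ x i ^ 2 ≠ q) ∧
    ∀ i j, i ≠ j → x i ≠ x j ∧ x i * x j ≠ 1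

/-- Koornwinder's `q`-difference operator, acting on functions of `x₁, …, xₙ`. -/
noncomputable def koornwinderOp {n : ℕ} (a b c d q t : ℂ) (F : (Fin n → ℂ) → ℂ)
    (x : Fin n → ℂ) : ℂ :=
  (∑ i, (1 - a * x i) * (1 - b * x i) * (1 - c * x i) * (1 - d * x i) /
        (alpha a b c d q * t ^ (n - 1) * (1 - x i ^ 2) * (1 - q * x i ^ 2)) *
      (∏ j ∈ Finset.univ.erase i,
        (1 - t * x i * x j) * (1 - t * x i / x j) / ((1 - x i * x j) * (1 - x i / x j))) *
      (F (Function.update x i (q * x i)) - F x)) +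
  ∑ i, (1 - a / x i) * (1 - b / x i) * (1 - c / x i) * (1 - d / x i) /
        (alpha a b c d q * t ^ (n - 1) * (1 - 1 / x i ^ 2) * (1 - q / x i ^ 2)) *
      (∏ j ∈ Finset.univ.erase i,
        (1 - t * x j / x i) * (1 - t / (x i * x j)) /
          ((1 - x j / x i) * (1 - 1 / (x i * x j)))) *
      (F (Function.update x i (q⁻¹ * x i)) - F x)

/-- `⟨x; y⟩ = x + x⁻¹ - y - y⁻¹`. -/
noncomputable def bracket (x y : ℂ) : ℂ := x + x⁻¹ - y - y⁻¹

/-- The eigenvalue `d_λ = ∑_{j=1}^n ⟨α t^{n-j} q^{λ_j}; α t^{n-j}⟩`; the index `j : Fin n` starts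
at `0` here. -/
noncomputable def eigenvalue {n : ℕ} (a b c d q t : ℂ) (lam : Fin n → ℕ) : ℂ :=
  ∑ j : Fin n, bracket (alpha a b c d q * t ^ (n - 1 - (j : ℕ)) * q ^ lam j)
    (alpha a b c d q * t ^ (n - 1 - (j : ℕ)))

/-- `P` satisfies the two conditions that characterize the Koornwinder polynomial `P_λ`:
it is `m_λ` plus a linear combination of the `m_μ` with `μ` a partition strictly below `λ` in the
dominance ordering (in particular it is `W_n`-invariant), and it is an eigenfunction of the
Koornwinder operator with eigenvalue `d_λ`. -/
structure IsKoornwinder {n : ℕ} (a b c d q t : ℂ) (lam : Fin n → ℕ) (P : Laurent n) : Prop where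
  triangular : P - monomialSymm lam ∈
    Submodule.span ℂ {m : Laurent n | ∃ μ : Fin n → ℕ, Antitone μ ∧ DominanceLE μ lam ∧ μ ≠ lam ∧
      m = monomialSymm μ}
  eigen : ∀ x : Fin n → ℂ, IsRegularPoint q x →
    koornwinderOp a b c d q t P.eval x = eigenvalue a b c d q t lam * P.eval x

open Classical in
/-- The Koornwinder polynomial `P_λ(x|a,b,c,d|q,t)` of type `BC_n`, for `λ : Fin n → ℕ`
(with the value `0` at parameters for which there is no such polynomial). -/
noncomputable def koornwinder {n : ℕ} (a b c d q t : ℂ) (lam : Fin n → ℕ) : Laurent n :=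
  if h : ∃ P, IsKoornwinder a b c d q t lam P then h.choose else 0

/-- The one column partition `(1^r) = (1, …, 1, 0, …, 0)` with `r` ones, for `r ≤ n`. -/
def column (n r : ℕ) : Fin n → ℕ := fun i => if (i : ℕ) < r then 1 else 0

/-- `P^{BC_n}_{(1^r)}(x|a,b,c,d|q,t)`, with the convention that it is `0` unless `0 ≤ r ≤ n`. -/
noncomputable def koornwinderColumn (n : ℕ) (a b c d q t : ℂ) (r : ℤ) : Laurent n :=
  if 0 ≤ r ∧ r ≤ n then koornwinder a b c d q t (column n r.toNat) else 0

/-- The function `f(s|a,b,c,d)`. -/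
noncomputable def f (a b c d t s : ℂ) : ℂ :=
  (1 - a * b * c * d * s / t) * (1 - t * s) * (1 - a * b * s) * (1 - a * c * s) *
      (1 - a * d * s) * (1 - b * c * s) * (1 - b * d * s) * (1 - c * d * s) /
    ((1 - a * b * c * d * s ^ 2 / t) * (1 - a * b * c * d * s ^ 2) ^ 2 *
      (1 - a * b * c * d * t * s ^ 2))

/-- The function `g₁(s|a,b,c,d)`. -/
noncomputable def g₁ (a b c d t s : ℂ) : ℂ :=
  (a + b + c + d - (a * b * c + a * b * d + a * c * d + b * c * d) * s / t) /
      (1 - a * b * c * d * s ^ 2 / t ^ 2) *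
    ((1 - s) / (1 - t))

/-- `g(s|a,b,c,d) = g₁(s|a,b,c,d) - g₁(st|a,b,c,d)`. -/
noncomputable def g (a b c d t s : ℂ) : ℂ := g₁ a b c d t s - g₁ a b c d t (s * t)

end Koornwinder

namespace Koornwinder

open Polynomial

/-! The one-column polynomials are the coefficients of a kernel. Put s_j = x_j + 1/x_j and let p_k
be the monic Askey-Wilson polynomials with base t in place of q. In the expansion ∏_j (Y - s_j) =
∑_k c_k(x) p_k(Y), the coefficient c_{n-r} equals (-1)^r P_{(1^r)}(x). Multiplying the kernel for n
- 1 variables by Y - s_n and using the three-term recurrence of p_k, whose coefficients are g(t^k)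
and f(t^k), gives the branching rule by comparing coefficients.

That c_k is an eigenfunction comes from `koornwinderOp_prod`: at Y = s_i only the two shifts of x_i
survive in the Koornwinder operator. The q-dependent denominators cancel, and what remains is a
scalar times the Askey-Wilson operator of base t in y = x_i, applied to the kernel in Y. Since p_k
are its eigenpolynomials, the defect of the desired eigenvalue equations is a polynomial in Y of
degree below n with the n distinct roots s_i, hence zero (`koornwinderOp_prodCoeff`).

The recurrence of p_k is proved from the operator. In the basis φ_j = ∏_{i<j} (Y - a t^i - 1/(a
t^i)) the operator is bidiagonal, so the coefficients of p_k are explicit products, and the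
recurrence reduces to rational identities (`awConn_one_recurrence`, `awConn_add_two_recurrence`).

For uniqueness, only the columns (1^s) with s < r lie strictly below (1^r), their eigenvalues differ
from that of (1^r), and the c_k are independent on regular points. -/

/-- The divided difference `(p(u) - p(v)) / (u - v)`, as a polynomial expression in `u` and `v`. -/
noncomputable def divDiff (u v : ℂ) (p : ℂ[X]) : ℂ := (p /ₘ (X - C v)).eval u

theorem divByMonic_X_sub_C_eq {v r : ℂ} {p s : ℂ[X]} (h : p = (X - C v) * s + C r) :
    p /ₘ (X - C v) = s :=
  (div_modByMonic_unique s (C r) (monic_X_sub_C v)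
    ⟨by rw [h]; ring, by
      rw [degree_X_sub_C]; exact degree_C_le.trans_lt (by norm_num)⟩).1

theorem eq_X_sub_C_mul_divByMonic_add (v : ℂ) (p : ℂ[X]) :
    p = (X - C v) * (p /ₘ (X - C v)) + C (p.eval v) := by
  conv_lhs => rw [← modByMonic_add_div p (X - C v), modByMonic_X_sub_C_eq_C_eval]
  ring

theorem divDiff_add (u v : ℂ) (p s : ℂ[X]) :
    divDiff u v (p + s) = divDiff u v p + divDiff u v s := by
  unfold divDiff
  rw [← eval_add, divByMonic_X_sub_C_eq (r := p.eval v + s.eval v)]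
  conv_lhs => rw [eq_X_sub_C_mul_divByMonic_add v p, eq_X_sub_C_mul_divByMonic_add v s]
  rw [C_add]; ring

theorem divDiff_C_mul (u v r : ℂ) (p : ℂ[X]) : divDiff u v (C r * p) = r * divDiff u v p := by
  unfold divDiff
  rw [← eval_C_mul, divByMonic_X_sub_C_eq (r := r * p.eval v)]
  conv_lhs => rw [eq_X_sub_C_mul_divByMonic_add v p]
  rw [C_mul]; ring

/-- The Leibniz rule for divided differences. Taking the quotient as a polynomial keeps everything
valid at u = v, which for u = ty + 1/(ty), v = y + 1/y happens when ty² = 1; regular points do not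
exclude this. -/
theorem divDiff_X_sub_C_mul (u v e : ℂ) (p : ℂ[X]) :
    divDiff u v ((X - C e) * p) = (u - e) * divDiff u v p + p.eval v := by
  unfold divDiff
  rw [divByMonic_X_sub_C_eq (s := (X - C e) * (p /ₘ (X - C v)) + C (p.eval v))
    (r := p.eval v * (v - e))]
  · simp
  · conv_lhs => rw [eq_X_sub_C_mul_divByMonic_add v p]
    simp only [C_mul, C_sub]; ring

theorem divDiff_one (u v : ℂ) : divDiff u v 1 = 0 := by
  unfold divDiff
  rw [divByMonic_X_sub_C_eq (s := 0) (r := 1)] <;> simp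

/-! ### The Askey-Wilson operator of base t on its adapted basis -/

/-- The coefficient of the upward shift in the Askey-Wilson operator, after cancellation of the
factor produced by the difference. -/
noncomputable def awCoeff (a b c d y : ℂ) : ℂ :=
  (1 - a * y) * (1 - b * y) * (1 - c * y) * (1 - d * y) / (y * (1 - y ^ 2))

/-- The value at `y` of the Askey-Wilson operator with base `t`, applied to the polynomial `p` in
`y + 1 / y`. -/
noncomputable def awOp (a b c d t y : ℂ) (p : ℂ[X]) : ℂ :=
  awCoeff a b c d y * divDiff (t * y + (t * y)⁻¹) (y + y⁻¹) p +
    awCoeff a b c d y⁻¹ * divDiff (t * y⁻¹ + (t * y⁻¹)⁻¹) (y + y⁻¹) p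

theorem awOp_add (a b c d t y : ℂ) (p s : ℂ[X]) :
    awOp a b c d t y (p + s) = awOp a b c d t y p + awOp a b c d t y s := by
  simp only [awOp, divDiff_add]; ring

theorem awOp_C_mul (a b c d t y r : ℂ) (p : ℂ[X]) :
    awOp a b c d t y (C r * p) = r * awOp a b c d t y p := by
  simp only [awOp, divDiff_C_mul]; ring

theorem awOp_sum {ι : Type*} (a b c d t y : ℂ) (s : Finset ι) (p : ι → ℂ[X]) :
    awOp a b c d t y (∑ i ∈ s, p i) = ∑ i ∈ s, awOp a b c d t y (p i) := by
  classical
  induction s using Finset.induction_on with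
  | empty =>
    have := awOp_C_mul a b c d t y 0 0
    simpa using this
  | insert i s hi ih => rw [Finset.sum_insert hi, Finset.sum_insert hi, awOp_add, ih]

/-- `1 + t + ⋯ + t^(k-1)`. -/
noncomputable def tNum (t : ℂ) (k : ℕ) : ℂ := ∑ i ∈ Finset.range k, t ^ i

theorem tNum_zero (t : ℂ) : tNum t 0 = 0 := by simp [tNum]

theorem tNum_succ (t : ℂ) (k : ℕ) : tNum t (k + 1) = tNum t k + t ^ k :=
  Finset.sum_range_succ _ _

theorem tNum_mul (t : ℂ) (k : ℕ) : tNum t k * (1 - t) = 1 - t ^ k := by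
  have := geom_sum_mul t k
  simp only [tNum]; linear_combination -this

/-- The zeros of the Askey-Wilson basis polynomials. -/
noncomputable def awNode (a t : ℂ) (j : ℕ) : ℂ := a * t ^ j + (a * t ^ j)⁻¹

/-- The monic Askey-Wilson basis. -/
noncomputable def awBasis (a t : ℂ) (j : ℕ) : ℂ[X] :=
  ∏ i ∈ Finset.range j, (X - C (awNode a t i))

theorem awBasis_succ (a t : ℂ) (j : ℕ) :
    awBasis a t (j + 1) = (X - C (awNode a t j)) * awBasis a t j := by
  rw [awBasis, Finset.prod_range_succ, mul_comm]; rfl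

/-- The eigenvalues of the Askey-Wilson operator; `B` stands for `abcd`. -/
noncomputable def awEigen (B t : ℂ) (k : ℕ) : ℂ :=
  tNum t k * t * (t ^ k)⁻¹ * (1 - B * t ^ k / t)

/-- The lowering coefficients of the Askey-Wilson operator. -/
noncomputable def awLower (a b c d t : ℂ) (k : ℕ) : ℂ :=
  tNum t k * t * (t ^ k)⁻¹ * ((1 - a * b * t ^ k / t) * (1 - a * c * t ^ k / t) *
    (1 - a * d * t ^ k / t) / (a * t ^ k / t))

/-- The part of `divDiff (t y + 1 / (t y)) (y + 1 / y) (awBasis a t (j + 1))` that depends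
on `y`. -/
noncomputable def awShift (a t y : ℂ) (j : ℕ) : ℂ :=
  ∏ i ∈ Finset.range j, -(a * t ^ i)⁻¹ * (1 - a * t ^ (i + 1) * y) * (1 - a * t ^ i * y⁻¹)

theorem sub_awNode {a t y : ℂ} (ha : a ≠ 0) (ht : t ≠ 0) (hy : y ≠ 0) (j : ℕ) :
    y + y⁻¹ - awNode a t j = -(a * t ^ j)⁻¹ * (1 - a * t ^ j * y) * (1 - a * t ^ j * y⁻¹) := by
  have : t ^ j ≠ 0 := pow_ne_zero _ ht
  unfold awNode; field_simp; ring

/-- Up to the same constant both sides are (ay;t)_{j+1} (a/y;t)_j. The product form avoids dividing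
by 1 - ay, which may vanish. -/
theorem awBasis_eval_mul {a t y : ℂ} (ha : a ≠ 0) (ht : t ≠ 0) (hy : y ≠ 0) (j : ℕ) :
    (awBasis a t j).eval (y + y⁻¹) * (1 - a * t ^ j * y) = (1 - a * y) * awShift a t y j := by
  induction j with
  | zero => simp [awBasis, awShift]
  | succ j ih =>
    rw [awBasis_succ, eval_mul, eval_sub, eval_X, eval_C, sub_awNode ha ht hy, awShift,
      Finset.prod_range_succ, ← awShift]
    linear_combination (-(a * t ^ j)⁻¹ * (1 - a * t ^ (j + 1) * y) * (1 - a * t ^ j * y⁻¹)) * ih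

theorem divDiff_awBasis {a t y : ℂ} (ha : a ≠ 0) (ht : t ≠ 0) (hy : y ≠ 0) (j : ℕ) :
    divDiff (t * y + (t * y)⁻¹) (y + y⁻¹) (awBasis a t (j + 1)) =
      tNum t (j + 1) * (t ^ j)⁻¹ * awShift a t y j := by
  induction j with
  | zero =>
    rw [awBasis_succ, divDiff_X_sub_C_mul]
    simp [awBasis, divDiff_one, tNum, awShift]
  | succ j ih =>
    have htj : t ^ j ≠ 0 := pow_ne_zero _ ht
    rw [awBasis_succ, divDiff_X_sub_C_mul, ih, sub_awNode ha ht (mul_ne_zero ht hy), awBasis_succ,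
      eval_mul, eval_sub, eval_X, eval_C, sub_awNode ha ht hy, awShift, awShift,
      Finset.prod_range_succ, ← awShift]
    have h := awBasis_eval_mul ha ht hy j
    have hs : tNum t (j + 1 + 1) = tNum t (j + 1) + t ^ (j + 1) := tNum_succ _ _
    have hm := tNum_mul t (j + 1)
    have e : -(a * t ^ j)⁻¹ * (1 - a * t ^ j * y) * (1 - a * t ^ j * y⁻¹) *
        (awBasis a t j).eval (y + y⁻¹) =
        -(a * t ^ j)⁻¹ * (1 - a * t ^ j * y⁻¹) * ((1 - a * y) * awShift a t y j) := by
      rw [← h]; ring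
    rw [e, hs]
    have e1 : (1 - a * t ^ (j + 1) * (t * y)⁻¹) = (1 - a * t ^ j * y⁻¹) := by
      field_simp
      ring
    rw [e1]
    simp only [pow_succ] at hm ⊢
    field_simp
    linear_combination (a * y * t * t ^ j * awShift a t y j * (a * t ^ j - y)) * hm

/-- The sum is symmetric under y ↦ 1/y, the poles at y = ±1 cancel, and the growth at infinity is
linear, so it is affine in y + 1/y. -/
theorem awCoeff_mul {b c d y z : ℂ} (hy : y ≠ 0) (hy2 : y ^ 2 ≠ 1) :
    (1 - b * y) * (1 - c * y) * (1 - d * y) / (y * (1 - y ^ 2)) * (1 - z * y) +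
      (1 - b * y⁻¹) * (1 - c * y⁻¹) * (1 - d * y⁻¹) / (y⁻¹ * (1 - y⁻¹ ^ 2)) * (1 - z * y⁻¹) =
    (1 - b * c * d * z) * (y + y⁻¹) - (b + c + d + z) + (b * c * d + z * (b * c + b * d + c * d)) := by
  have h1 : 1 - y ^ 2 ≠ 0 := sub_ne_zero.2 hy2.symm
  have h2 : y ^ 2 - 1 ≠ 0 := sub_ne_zero.2 hy2
  have e : y⁻¹ * (1 - y⁻¹ ^ 2) = -(1 - y ^ 2) / y ^ 3 := by field_simp; ring
  rw [e]
  field_simp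
  ring

theorem awOp_awBasis_zero (a b c d t y : ℂ) : awOp a b c d t y (awBasis a t 0) = 0 := by
  simp [awOp, awBasis, divDiff_one]

/-- The factor 1 - ay of `awCoeff` converts the shifted product `awShift` into φ_j times 1 - a t^j
y. Then `awCoeff_mul` with z = a t^j leaves φ_j times an affine function of y + 1/y; splitting off
the multiple of y + 1/y - `awNode a t j` yields the two terms. -/
theorem awOp_awBasis_succ {a b c d t y : ℂ} (ha : a ≠ 0) (ht : t ≠ 0) (hy : y ≠ 0)
    (hy2 : y ^ 2 ≠ 1) (j : ℕ) :
    awOp a b c d t y (awBasis a t (j + 1)) =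
      awEigen (a * b * c * d) t (j + 1) * (awBasis a t (j + 1)).eval (y + y⁻¹) +
        awLower a b c d t (j + 1) * (awBasis a t j).eval (y + y⁻¹) := by
  have htj : t ^ j ≠ 0 := pow_ne_zero _ ht
  have h1 := divDiff_awBasis ha ht hy j
  have h2 := divDiff_awBasis ha ht (inv_ne_zero hy) j
  have s1 := awBasis_eval_mul ha ht hy j
  have s2 := awBasis_eval_mul ha ht (inv_ne_zero hy) j
  rw [inv_inv, add_comm y⁻¹ y] at h2 s2
  have key := awCoeff_mul (b := b) (c := c) (d := d) (z := a * t ^ j) hy hy2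
  rw [awOp, h1, h2, awBasis_succ, eval_mul, eval_sub, eval_X, eval_C]
  set P := (awBasis a t j).eval (y + y⁻¹)
  have : ∀ w S : ℂ, P * (1 - a * t ^ j * w) = (1 - a * w) * S →
      awCoeff a b c d w * (tNum t (j + 1) * (t ^ j)⁻¹ * S) = tNum t (j + 1) * (t ^ j)⁻¹ * P *
        ((1 - b * w) * (1 - c * w) * (1 - d * w) / (w * (1 - w ^ 2)) * (1 - a * t ^ j * w)) := by
    intro w S h
    unfold awCoeff
    linear_combination -(tNum t (j + 1) * (t ^ j)⁻¹ * ((1 - b * w) * (1 - c * w) * (1 - d * w) / (w * (1 - w ^ 2)))) * h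
  rw [this _ _ s1, this _ _ s2, ← mul_add, key, awEigen, awLower, awNode]
  simp only [pow_succ]
  field_simp
  ring

/-! ### Rational identities behind the three-term recurrence -/

-- The core of `awConn_add_two_identity` in the symmetric functions p, r of b, c, d, with B = abcd.
-- The denominators are separate variables, multiplied by powers of t where needed, so that they
-- stay atomic while fractions are cleared.
set_option maxRecDepth 10000 in
theorem awConn_add_two_identity_of_symmetric {a B p r t u v s D0 D1 D2 E N0 N1 N2 : ℂ} (ha : a ≠ 0) (ht : t ≠ 0) (hu : u ≠ 0)
    (hv : v ≠ 0) (hs : s = t * u * v) (hN0 : N0 = 1 - t) (hN1 : N1 = 1 - t * v)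
    (hN2 : N2 = 1 - t ^ 2 * v) (hN0' : N0 ≠ 0) (hN1' : N1 ≠ 0) (hN2' : N2 ≠ 0)
    (hD2 : D2 = t ^ 2 - B * s ^ 2) (hD1 : D1 = t - B * s ^ 2) (hD0 : D0 = 1 - B * s ^ 2)
    (hE : E = t ^ 2 - B * s * u) (hD2' : D2 ≠ 0) (hD1' : D1 ≠ 0) (hD0' : D0 ≠ 0) (hE' : E ≠ 0) :
    E * v / (N1 * a * s) *
      ((1 - u) / N2 * (s / u) * (t ^ 2 / E) * (t / (a * u)) *
          (1 - a * p * (u / t) + a ^ 2 * r * (u / t) ^ 2 - a ^ 2 * B * (u / t) ^ 3) +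
        (a * u + (a * u)⁻¹) +
        ((a + p - (B / a + a * r) * s / t) * t ^ 2 / D2 * ((1 - s) / N0) -
          (a + p - (B / a + a * r) * s) / D0 * ((1 - s * t) / N0)) -
        (1 - s * t) / N2 / (a * s) * ((1 - B * s * u / t) * v * t ^ 2) / (D0 * D1) *
          (1 - a * p * s + a ^ 2 * r * s ^ 2 - a ^ 2 * B * s ^ 3)) =
    (1 - B * s / t ^ 2) *
      (1 - r * (s / t) + p * (B / a) * (s / t) ^ 2 - (B / a) ^ 2 * (s / t) ^ 3) *
      t ^ 4 / (D2 * D1) := by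
  have hs0 : s ≠ 0 := by rw [hs]; positivity
  field_simp
  rw [hD0, hD1, hD2, hE, hN0, hN1, hN2]
  subst hs
  ring

-- With u = t^j, v = t^l, s = t^(j+l+1), this is the coefficient of φ_j in the recurrence for
-- p_{j+l+2}, with the common factor `awConn a b c d t j l` removed and solved for f.
set_option maxRecDepth 10000 in
theorem awConn_add_two_identity {a b c d t s u v D0 D1 D2 D3 E N0 N1 N2 : ℂ} (ha : a ≠ 0) (ht : t ≠ 0)
    (hu : u ≠ 0) (hv : v ≠ 0)
    (hs : s = t * u * v) (hN0 : N0 = 1 - t) (hN1 : N1 = 1 - t * v)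
    (hN2 : N2 = 1 - t ^ 2 * v) (hN0' : N0 ≠ 0) (hN1' : N1 ≠ 0) (hN2' : N2 ≠ 0)
    (hD3 : D3 = 1 - a * b * c * d * s ^ 2 / t ^ 3) (hD2 : D2 = 1 - a * b * c * d * s ^ 2 / t ^ 2)
    (hD1 : D1 = 1 - a * b * c * d * s ^ 2 / t) (hD0 : D0 = 1 - a * b * c * d * s ^ 2)
    (hE : E = 1 - a * b * c * d * s * u / t ^ 2)
    (hD3' : D3 ≠ 0) (hD2' : D2 ≠ 0) (hD1' : D1 ≠ 0) (hD0' : D0 ≠ 0) (hE' : E ≠ 0) :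
    (1 - s) / N0 * t / s * ((1 - a * b * s / t) * (1 - a * c * s / t) * (1 - a * d * s / t) /
        (a * s / t)) * (E * v) / (N1 / N0 * t / s * D2 * D3) *
      ((1 - u) / N0 * t / u * ((1 - a * b * u / t) * (1 - a * c * u / t) *
        (1 - a * d * u / t) / (a * u / t)) / (N2 / N0 * t / s * E) + (a * u + (a * u)⁻¹) +
        g a b c d t s -
        (1 - s * t) / N0 / s * ((1 - a * b * s) * (1 - a * c * s) * (1 - a * d * s) / (a * s)) *
          ((1 - a * b * c * d * s * u / t) * (v * t)) / (N2 / N0 / s * D0 * D1)) =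
    f a b c d t (s / t) := by
  have hs0 : s ≠ 0 := by rw [hs]; positivity
  have key := awConn_add_two_identity_of_symmetric (B := a * b * c * d) (p := b + c + d) (r := b * c + b * d + c * d)
    (D0 := D0) (D1 := D1 * t) (D2 := D2 * t ^ 2) (E := E * t ^ 2) ha ht hu hv hs hN0 hN1 hN2
    hN0' hN1' hN2' (by rw [hD2]; field_simp) (by rw [hD1]; field_simp) hD0
    (by rw [hE]; field_simp) (by positivity) (by positivity) hD0' (by positivity)
  have e6 : 1 - a * b * c * d * (s / t) ^ 2 / t = D3 := by rw [hD3]; field_simp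
  have e7 : 1 - a * b * c * d * (s / t) ^ 2 = D2 := by rw [hD2]; field_simp
  have e8 : 1 - a * b * c * d * t * (s / t) ^ 2 = D1 := by rw [hD1]; field_simp
  have e1 : 1 - a * b * c * d * (s * t) ^ 2 / t ^ 2 = D0 := by rw [hD0]; field_simp
  unfold f g g₁
  rw [e6, e7, e8, e1, ← hN0, ← hD2]
  have hf : (1 - a * b * c * d * (s / t) / t) * (1 - t * (s / t)) * (1 - a * b * (s / t)) *
      (1 - a * c * (s / t)) * (1 - a * d * (s / t)) * (1 - b * c * (s / t)) *
      (1 - b * d * (s / t)) * (1 - c * d * (s / t)) / (D3 * D2 ^ 2 * D1) =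
      (1 - s) * ((1 - a * b * s / t) * (1 - a * c * s / t) * (1 - a * d * s / t)) * t /
        (D2 * D3 * t ^ 2) * ((1 - (a * b * c * d) * s / t ^ 2) *
      (1 - (b * c + b * d + c * d) * (s / t) + (b + c + d) * ((a * b * c * d) / a) * (s / t) ^ 2 -
        ((a * b * c * d) / a) ^ 2 * (s / t) ^ 3) *
      t ^ 4 / (D2 * t ^ 2 * (D1 * t))) := by
    have e9 : (1 - t * (s / t)) = 1 - s := by field_simp
    rw [e9]
    have e10 : (a * b * c * d) / a = b * c * d := by field_simp
    rw [e10]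
    field_simp
    ring
  rw [hf, ← key]
  have e11 : (a * b * c * d) / a = b * c * d := by field_simp
  rw [e11]
  have A1 : (1 - s) / N0 * t / s * ((1 - a * b * s / t) * (1 - a * c * s / t) *
      (1 - a * d * s / t) / (a * s / t)) * (E * v) / (N1 / N0 * t / s * D2 * D3) =
      (1 - s) * ((1 - a * b * s / t) * (1 - a * c * s / t) * (1 - a * d * s / t)) * t /
        (D2 * D3 * t ^ 2) * (E * t ^ 2 * v / (N1 * a * s)) := by
    field_simp
  rw [A1, mul_assoc]
  congr 2
  have B1 : (1 - u) / N0 * t / u * ((1 - a * b * u / t) * (1 - a * c * u / t) *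
        (1 - a * d * u / t) / (a * u / t)) / (N2 / N0 * t / s * E) =
      (1 - u) / N2 * (s / u) * (t ^ 2 / (E * t ^ 2)) * (t / (a * u)) *
          (1 - a * (b + c + d) * (u / t) + a ^ 2 * (b * c + b * d + c * d) * (u / t) ^ 2 -
            a ^ 2 * (a * b * c * d) * (u / t) ^ 3) := by
    field_simp
    ring
  have B2 : (1 - s * t) / N0 / s * ((1 - a * b * s) * (1 - a * c * s) * (1 - a * d * s) / (a * s)) *
          ((1 - a * b * c * d * s * u / t) * (v * t)) / (N2 / N0 / s * D0 * D1) =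
      (1 - s * t) / N2 / (a * s) * ((1 - a * b * c * d * s * u / t) * v * t ^ 2) / (D0 * (D1 * t)) *
          (1 - a * (b + c + d) * s + a ^ 2 * (b * c + b * d + c * d) * s ^ 2 -
            a ^ 2 * (a * b * c * d) * s ^ 3) := by
    field_simp
    ring
  rw [B1, B2]
  congr 2
  field_simp
  ring

/-- With s = t^j, this compares the subleading coefficients of p_{j+1} and p_j; the difference fixes
g(t^j). -/
theorem awConn_one_identity {a b c d t s D0 D2 N0 : ℂ} (ha : a ≠ 0) (ht : t ≠ 0) (hs : s ≠ 0)
    (hN0 : N0 = 1 - t) (hN0' : N0 ≠ 0) (hD2 : D2 = 1 - a * b * c * d * s ^ 2 / t ^ 2)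
    (hD0 : D0 = 1 - a * b * c * d * s ^ 2) (hD2' : D2 ≠ 0) (hD0' : D0 ≠ 0) :
    (1 - s * t) / N0 / s * ((1 - a * b * s) * (1 - a * c * s) * (1 - a * d * s) / (a * s)) /
        (D0 / s) =
      (1 - s) / N0 * t / s * ((1 - a * b * s / t) * (1 - a * c * s / t) * (1 - a * d * s / t) /
        (a * s / t)) / (t / s * D2) + (a * s + (a * s)⁻¹) + g a b c d t s := by
  have e1 : 1 - a * b * c * d * (s * t) ^ 2 / t ^ 2 = D0 := by rw [hD0]; field_simp
  unfold g g₁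
  rw [e1, ← hN0, ← hD2]
  have hD2'' : t ^ 2 * D2 = t ^ 2 - a * b * c * d * s ^ 2 := by rw [hD2]; field_simp
  generalize hE2 : t ^ 2 * D2 = E2 at hD2''
  have hE2' : E2 ≠ 0 := by rw [← hE2]; positivity
  have : D2 = E2 / t ^ 2 := by rw [← hE2]; field_simp
  rw [this]
  field_simp
  rw [hD2'', hN0, hD0]
  ring

/-! ### Genericity and the connection coefficients -/

/-- Genericity of the parameters for polynomials of degree at most `n`. -/
structure Generic (n : ℕ) (a b c d t : ℂ) : Prop where
  a_ne : a ≠ 0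
  t_ne : t ≠ 0
  t_pow : ∀ k : ℕ, 1 ≤ k → k ≤ n → t ^ k ≠ 1
  abcd : ∀ k : ℤ, -2 ≤ k → k ≤ 2 * n - 2 → a * b * c * d * t ^ k ≠ 1

namespace Generic

variable {n : ℕ} {a b c d t : ℂ}

theorem one_sub_ne (h : Generic n a b c d t) (i j : ℕ) (h1 : j ≤ i + 2) (h2 : i + 2 ≤ 2 * n + j) :
    1 - a * b * c * d * t ^ i / t ^ j ≠ 0 := by
  have := h.abcd ((i : ℤ) - j) (by omega) (by omega)
  rw [zpow_sub₀ h.t_ne, zpow_natCast, zpow_natCast, ← mul_div_assoc] at this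
  exact sub_ne_zero.2 this.symm

theorem tNum_ne (h : Generic n a b c d t) (k : ℕ) (h1 : 1 ≤ k) (h2 : k ≤ n) : tNum t k ≠ 0 := by
  intro h0
  have := tNum_mul t k
  rw [h0, zero_mul] at this
  exact h.t_pow k h1 h2 (sub_eq_zero.1 this.symm).symm

theorem one_sub_t_ne (h : Generic n a b c d t) (hn : 1 ≤ n) : 1 - t ≠ 0 := by
  have := h.t_pow 1 le_rfl hn
  rw [pow_one] at this
  exact sub_ne_zero.2 this.symm

theorem tNum_eq (h : Generic n a b c d t) (hn : 1 ≤ n) (k : ℕ) :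
    tNum t k = (1 - t ^ k) / (1 - t) := by
  rw [eq_div_iff (h.one_sub_t_ne hn), tNum_mul]

end Generic

theorem tNum_add (t : ℂ) (j l : ℕ) : tNum t (j + l) = tNum t j + t ^ j * tNum t l := by
  simp only [tNum, Finset.sum_range_add, pow_add, Finset.mul_sum]

/-- The factored form shows that eigenvalues are separated exactly by the conditions on powers of t
and on abcd times powers of t. -/
theorem awEigen_sub {B t : ℂ} (ht : t ≠ 0) (j l : ℕ) :
    awEigen B t (j + l) - awEigen B t j =
      tNum t l * t * (t ^ (j + l))⁻¹ * (1 - B * t ^ (2 * j + l) / t) := by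
  have hj : t ^ j ≠ 0 := pow_ne_zero _ ht
  have hl : t ^ l ≠ 0 := pow_ne_zero _ ht
  have h1 := tNum_add t j l
  have h2 := tNum_add t l j
  rw [add_comm l j] at h2
  have h3 : t ^ l * tNum t j = tNum t (j + l) - tNum t l := by rw [h2]; ring
  have h4 : t ^ j * tNum t l = tNum t (j + l) - tNum t j := by rw [h1]; ring
  unfold awEigen
  have e : t ^ (2 * j + l) = t ^ j * t ^ j * t ^ l := by ring
  rw [e, pow_add]
  field_simp
  linear_combination -t * h3 + B * t ^ j * t ^ l * h4

/-- The coefficient of `awBasis a t j` in the monic Askey-Wilson polynomial of degree `j + l`. -/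
noncomputable def awConn (a b c d t : ℂ) (j l : ℕ) : ℂ :=
  ∏ i ∈ Finset.range l, awLower a b c d t (j + i + 1) /
    (awEigen (a * b * c * d) t (j + l) - awEigen (a * b * c * d) t (j + i))

theorem awConn_zero (a b c d t : ℂ) (j : ℕ) : awConn a b c d t j 0 = 1 := by simp [awConn]

section

variable {n : ℕ} {a b c d t : ℂ}

theorem Generic.awEigen_sub_ne (h : Generic n a b c d t) (j l : ℕ) (hl : 1 ≤ l) (hn : j + l ≤ n) :
    awEigen (a * b * c * d) t (j + l) - awEigen (a * b * c * d) t j ≠ 0 := by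
  rw [awEigen_sub h.t_ne]
  have h1 := h.one_sub_ne (2 * j + l) 1 (by omega) (by omega)
  rw [pow_one] at h1
  have h2 := h.tNum_ne l hl (by omega)
  have := h.t_ne
  positivity

/-- This is the coefficient of φ_j in the eigenvalue equation of p_{j+l+1}. -/
theorem awConn_succ_mul (h : Generic n a b c d t) (j l : ℕ) (hn : j + l + 1 ≤ n) :
    awConn a b c d t j (l + 1) *
        (awEigen (a * b * c * d) t (j + l + 1) - awEigen (a * b * c * d) t j) =
      awLower a b c d t (j + 1) * awConn a b c d t (j + 1) l := by
  have h1 := h.awEigen_sub_ne j (l + 1) (by omega) hn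
  rw [← add_assoc] at h1
  unfold awConn
  rw [Finset.prod_range_succ']
  have : ∀ i, awLower a b c d t (j + (i + 1) + 1) / (awEigen (a * b * c * d) t (j + (l + 1)) -
      awEigen (a * b * c * d) t (j + (i + 1))) = awLower a b c d t (j + 1 + i + 1) /
      (awEigen (a * b * c * d) t (j + 1 + l) - awEigen (a * b * c * d) t (j + 1 + i)) := by
    intro i
    rw [show j + (i + 1) = j + 1 + i by omega, show j + (l + 1) = j + 1 + l by omega]
  simp only [this, add_zero]
  rw [← add_assoc, mul_assoc, div_mul_cancel₀ _ h1, mul_comm]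

/-- The ratio of the coefficients of φ_j in p_{j+l+1} and p_{j+l} is also rational in powers of t.
Raising j by one in both lowers l, whence the induction on l for all j at once. -/
theorem awConn_degree_step (h : Generic n a b c d t) (j l : ℕ) (hn : j + l + 1 ≤ n) :
    awConn a b c d t j (l + 1) * (tNum t (l + 1) * (t ^ (j + l))⁻¹ *
        (1 - a * b * c * d * t ^ (2 * j + 2 * l)) * (1 - a * b * c * d * t ^ (2 * j + 2 * l) / t)) =
      awConn a b c d t j l * (awLower a b c d t (j + l + 1) *
        ((1 - a * b * c * d * t ^ (2 * j + l) / t) * t ^ l)) := by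
  have ht := h.t_ne
  induction l generalizing j with
  | zero =>
    have h1 := awConn_succ_mul h j 0 hn
    have h2 := awEigen_sub (B := a * b * c * d) ht j 1
    rw [add_zero, h2, awConn_zero] at h1
    rw [awConn_zero]
    have e : t ^ (2 * j + 1) = t ^ (2 * j) * t := pow_succ _ _
    rw [e, pow_succ] at h1
    have hj : t ^ j ≠ 0 := pow_ne_zero _ ht
    have e1 : t * (t ^ j * t)⁻¹ = (t ^ j)⁻¹ := by field_simp
    have e2 : a * b * c * d * (t ^ (2 * j) * t) / t = a * b * c * d * t ^ (2 * j) := by field_simp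
    rw [e2, mul_assoc (tNum t 1), e1] at h1
    simp only [mul_zero, add_zero, zero_add, pow_zero] at h1 ⊢
    linear_combination (1 - a * b * c * d * t ^ (2 * j) / t) * h1
  | succ l ih =>
    have i1 := ih (j + 1) (by omega)
    have r1 := awConn_succ_mul h j (l + 1) hn
    have r2 := awConn_succ_mul h j l (by omega)
    have e1 := awEigen_sub (B := a * b * c * d) ht j (l + 2)
    have e2 := awEigen_sub (B := a * b * c * d) ht j (l + 1)
    simp only [← add_assoc] at e1 e2 r1 r2
    rw [show j + l + 1 + 1 = j + l + 2 by omega, e1] at r1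
    rw [e2] at r2
    rw [show j + 1 + l + 1 = j + (l + 1) + 1 by omega] at i1
    generalize awLower a b c d t (j + (l + 1) + 1) = w at i1 ⊢
    have n1 : tNum t (l + 1) * (t ^ (j + l + 1))⁻¹ *
        (1 - a * b * c * d * t ^ (2 * j + l + 1)) ≠ 0 := by
      have k1 := h.one_sub_ne (2 * j + l + 1) 0 (by omega) (by omega)
      have k2 := h.tNum_ne (l + 1) (by omega) (by omega)
      rw [pow_zero, div_one] at k1
      positivity
    have hj : t ^ j ≠ 0 := pow_ne_zero _ ht
    have hl : t ^ l ≠ 0 := pow_ne_zero _ ht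
    -- The cancelled factor supplies what the left side of the goal lacks for `r1` and then `i1` to
    -- apply.
    refine mul_right_cancel₀ n1 ?_
    have p1 : a * b * c * d * t ^ (2 * j + l + 2) / t = a * b * c * d * t ^ (2 * j + l + 1) := by
      field_simp; ring
    have p2 : a * b * c * d * t ^ (2 * j + l + 1) / t = a * b * c * d * t ^ (2 * j + l) := by
      field_simp; ring
    have p3 : a * b * c * d * t ^ (2 * (j + 1) + l) / t = a * b * c * d * t ^ (2 * j + l + 1) := by
      rw [show 2 * (j + 1) + l = 2 * j + l + 2 by omega, p1]
    have p4 : a * b * c * d * t ^ (2 * j + (l + 1)) / t = a * b * c * d * t ^ (2 * j + l) := by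
      rw [← add_assoc, p2]
    rw [p1] at r1
    rw [p2] at r2
    rw [p3, show 2 * (j + 1) + 2 * l = 2 * j + 2 * (l + 1) by omega,
      show j + 1 + l = j + l + 1 by omega] at i1
    rw [p4, ← add_assoc]
    have q1 : t * (t ^ (j + l + 2))⁻¹ = (t ^ (j + l + 1))⁻¹ := by field_simp; ring
    have q2 : t * (t ^ (j + l + 1))⁻¹ = (t ^ (j + l))⁻¹ := by field_simp; ring
    have q3 : t ^ (l + 1) * (t ^ (j + l + 1))⁻¹ = t ^ l * (t ^ (j + l))⁻¹ := by field_simp; ring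
    rw [mul_assoc (tNum t (l + 2)), q1] at r1
    rw [mul_assoc (tNum t (l + 1)), q2] at r2
    generalize t ^ (2 * j + 2 * (l + 1)) = P at *
    generalize 1 - a * b * c * d * t ^ (2 * j + l + 1) = Q at *
    generalize 1 - a * b * c * d * t ^ (2 * j + l) = Q' at *
    generalize (t ^ (j + l + 1))⁻¹ = I at *
    linear_combination (tNum t (l + 1) * I * (1 - a * b * c * d * P) *
        (1 - a * b * c * d * P / t)) * r1 + awLower a b c d t (j + 1) * i1 -
      (w * Q * t ^ l) * r2 - awConn a b c d t j (l + 1) * w * Q' * tNum t (l + 1) * Q * q3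

end

/-! ### Askey-Wilson polynomials: eigenvalue equation and three-term recurrence -/

section AskeyWilson

variable {n : ℕ} {a b c d t : ℂ}

/-- The monic Askey-Wilson polynomial of degree `k` with base `t`, in the variable `y + 1 / y`. -/
noncomputable def awPoly (a b c d t : ℂ) (k : ℕ) : ℂ[X] :=
  ∑ p ∈ Finset.HasAntidiagonal.antidiagonal k, C (awConn a b c d t p.1 p.2) * awBasis a t p.1

theorem awOp_awPoly (h : Generic n a b c d t) (k : ℕ) (hk : k ≤ n) {y : ℂ} (hy : y ≠ 0)
    (hy2 : y ^ 2 ≠ 1) :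
    awOp a b c d t y (awPoly a b c d t k) =
      awEigen (a * b * c * d) t k * (awPoly a b c d t k).eval (y + y⁻¹) := by
  unfold awPoly
  rw [awOp_sum]
  simp only [awOp_C_mul, eval_finsetSum, eval_mul, eval_C]
  cases k with
  | zero => simp [awOp_awBasis_zero, awEigen, tNum_zero]
  | succ k =>
    set P : ℕ → ℂ := fun j => (awBasis a t j).eval (y + y⁻¹) with hP
    set e : ℕ → ℂ := awEigen (a * b * c * d) t with he
    have A : ∑ p ∈ Finset.HasAntidiagonal.antidiagonal (k + 1), awConn a b c d t p.1 p.2 *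
        (e (k + 1) - e p.1) * P p.1 =
        ∑ p ∈ Finset.HasAntidiagonal.antidiagonal k, awLower a b c d t (p.1 + 1) *
          awConn a b c d t (p.1 + 1) p.2 * P p.1 := by
      -- The top term j = k + 1 drops out because its eigenvalue difference is zero.
      rw [Finset.Nat.sum_antidiagonal_succ']
      simp only [sub_self, mul_zero, zero_mul, zero_add]
      refine Finset.sum_congr rfl fun p hp => ?_
      have hp' := Finset.HasAntidiagonal.mem_antidiagonal.1 hp
      have := awConn_succ_mul h p.1 p.2 (by omega)
      rw [hp'] at this
      rw [← this]
    have A1 : ∑ p ∈ Finset.HasAntidiagonal.antidiagonal (k + 1), awConn a b c d t p.1 p.2 *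
        (e (k + 1) - e p.1) * P p.1 =
        e (k + 1) * ∑ p ∈ Finset.HasAntidiagonal.antidiagonal (k + 1), awConn a b c d t p.1 p.2 * P p.1 -
          ∑ p ∈ Finset.HasAntidiagonal.antidiagonal (k + 1), awConn a b c d t p.1 p.2 * e p.1 * P p.1 := by
      rw [Finset.mul_sum, ← Finset.sum_sub_distrib]
      exact Finset.sum_congr rfl fun p _ => by ring
    have A2 : ∑ p ∈ Finset.HasAntidiagonal.antidiagonal (k + 1), awConn a b c d t p.1 p.2 * e p.1 * P p.1 =
        ∑ p ∈ Finset.HasAntidiagonal.antidiagonal k, awConn a b c d t (p.1 + 1) p.2 * e (p.1 + 1) *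
          P (p.1 + 1) := by
      rw [Finset.Nat.sum_antidiagonal_succ]
      simp [he, awEigen, tNum_zero]
    rw [Finset.Nat.sum_antidiagonal_succ (f := fun p =>
      awConn a b c d t p.1 p.2 * awOp a b c d t y (awBasis a t p.1))]
    simp only [awOp_awBasis_zero, mul_zero, zero_add, awOp_awBasis_succ h.a_ne h.t_ne hy hy2]
    have A3 := A1.symm.trans A
    rw [A2, sub_eq_iff_eq_add, ← Finset.sum_add_distrib] at A3
    exact (Finset.sum_congr rfl fun p _ => by ring).trans A3.symm

/-- The coefficient following `awConn a b c d t (j - 1) l`, which is zero for `j = 0`. -/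
noncomputable def awConnPred (a b c d t : ℂ) : ℕ → ℕ → ℂ
  | 0, _ => 0
  | j + 1, l => awConn a b c d t j l

theorem awConnPred_succ (h : Generic n a b c d t) (j l : ℕ) (hn : j + l ≤ n) :
    awConnPred a b c d t j (l + 1) = awLower a b c d t j * awConn a b c d t j l /
      (tNum t (l + 1) * t * (t ^ (j + l))⁻¹ *
        (1 - a * b * c * d * t ^ (2 * j + l + 1) / t ^ 3)) := by
  have ht := h.t_ne
  cases j with
  -- The convention for a missing predecessor fits the formula since the lowering coefficient
  -- vanishes at index 0.
  | zero => simp [awConnPred, awLower, tNum_zero]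
  | succ j =>
    have h1 := awConn_succ_mul h j l (by omega)
    have h2 := h.awEigen_sub_ne j (l + 1) (by omega) (by omega)
    have h3 := awEigen_sub (B := a * b * c * d) ht j (l + 1)
    rw [← add_assoc] at h2 h3
    have e : a * b * c * d * t ^ (2 * (j + 1) + l + 1) / t ^ 3 =
        a * b * c * d * t ^ (2 * j + (l + 1)) / t := by
      field_simp; ring
    rw [e, show j + 1 + l = j + l + 1 by omega, ← h3, eq_div_iff h2, ← h1]
    rfl

/-- The coefficient of φ_j in the recurrence for p_{j+1}: p_{j-1} does not reach φ_j, so f is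
absent. -/
theorem awConn_one_recurrence (h : Generic n a b c d t) (j : ℕ) (hn : j + 1 ≤ n) :
    awConn a b c d t j 1 = awConnPred a b c d t j 1 + awNode a t j + g a b c d t (t ^ j) := by
  have ht := h.t_ne
  have h1 := awConn_succ_mul h j 0 hn
  have hd := awEigen_sub (B := a * b * c * d) ht j 1
  have hd0 := h.awEigen_sub_ne j 1 le_rfl hn
  simp only [add_zero, awConn_zero, mul_one, zero_add] at h1
  rw [← eq_div_iff hd0] at h1
  have h2 := awConnPred_succ h j 0 (by omega)
  simp only [add_zero, awConn_zero, mul_one, zero_add] at h2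
  have hD2 := h.one_sub_ne (2 * j) 2 (by omega) (by omega)
  have hD0 := h.one_sub_ne (2 * j) 0 (by omega) (by omega)
  have e : t ^ (2 * j) = (t ^ j) ^ 2 := by ring
  rw [pow_zero, div_one] at hD0
  rw [e] at hD2 hD0
  have hj : t ^ j ≠ 0 := pow_ne_zero _ ht
  have key := awConn_one_identity (b := b) (c := c) (d := d) h.a_ne ht hj rfl
    (h.one_sub_t_ne (by omega)) rfl rfl hD2 hD0
  have n1 : tNum t 1 = 1 := by simp [tNum]
  rw [h1, h2, hd, n1, awNode, add_assoc _ _ (g a b c d t (t ^ j)), ← add_assoc]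
  refine Eq.trans ?_ (key.trans ?_)
  · rw [awLower, h.tNum_eq (by omega)]
    have e1 : t ^ (2 * j + 1) / t = (t ^ j) ^ 2 := by field_simp; ring
    have e2 : ∀ w, w * t ^ (j + 1) / t = w * t ^ j := by intro w; field_simp; ring
    simp only [e2, mul_div_assoc (a * b * c * d), e1]
    rw [pow_succ]
    field_simp
  · rw [awLower, h.tNum_eq (by omega)]
    have e1 : t ^ (2 * j + 1) / t ^ 3 = (t ^ j) ^ 2 / t ^ 2 := by field_simp; ring
    simp only [mul_div_assoc (a * b * c * d), e1]
    congr 3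
    field_simp

theorem awLower_eq (h : Generic n a b c d t) (hn : 1 ≤ n) (k : ℕ) :
    awLower a b c d t k = (1 - t ^ k) / (1 - t) * t / t ^ k * ((1 - a * b * t ^ k / t) *
      (1 - a * c * t ^ k / t) * (1 - a * d * t ^ k / t) / (a * t ^ k / t)) := by
  rw [awLower, h.tNum_eq hn]
  ring

theorem awConn_add_two_recurrence (h : Generic n a b c d t) (j l : ℕ) (hn : j + l + 2 ≤ n) :
    awConn a b c d t j (l + 2) = awConnPred a b c d t j (l + 2) +
      (awNode a t j + g a b c d t (t ^ (j + l + 1))) * awConn a b c d t j (l + 1) -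
        f a b c d t (t ^ (j + l)) * awConn a b c d t j l := by
  have ht := h.t_ne
  have hj : t ^ j ≠ 0 := pow_ne_zero _ ht
  have hl : t ^ l ≠ 0 := pow_ne_zero _ ht
  have r1 := awConn_degree_step h j l (by omega)
  have r2 := awConn_degree_step h j (l + 1) (by omega)
  have hs : t ^ (j + l + 1) = t * t ^ j * t ^ l := by ring
  have hD3 := h.one_sub_ne (2 * j + 2 * l + 2) 3 (by omega) (by omega)
  have hD2 := h.one_sub_ne (2 * j + 2 * l + 2) 2 (by omega) (by omega)
  have hD1 := h.one_sub_ne (2 * j + 2 * l + 2) 1 (by omega) (by omega)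
  have hD0 := h.one_sub_ne (2 * j + 2 * l + 2) 0 (by omega) (by omega)
  have hE := h.one_sub_ne (2 * j + l + 1) 2 (by omega) (by omega)
  have hN0 := h.one_sub_t_ne (by omega)
  have hN1 := sub_ne_zero.2 (h.t_pow (l + 1) (by omega) (by omega)).symm
  have hN2 := sub_ne_zero.2 (h.t_pow (l + 2) (by omega) (by omega)).symm
  have es : t ^ (2 * j + 2 * l + 2) = (t ^ (j + l + 1)) ^ 2 := by ring
  have eE : t ^ (2 * j + l + 1) = t ^ (j + l + 1) * t ^ j := by ring
  rw [pow_zero, div_one] at hD0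
  rw [pow_one] at hD1
  rw [es] at hD0 hD1 hD2 hD3
  rw [eE, ← mul_assoc] at hE
  have key := awConn_add_two_identity (b := b) (c := c) (d := d) h.a_ne ht hj hl hs rfl
    (N1 := 1 - t ^ (l + 1)) (N2 := 1 - t ^ (l + 2)) (by ring) (by ring) hN0 hN1 hN2 rfl rfl rfl rfl
    rfl hD3 hD2 hD1 hD0 hE
  have hs0 : t ^ (j + l + 1) ≠ 0 := pow_ne_zero _ ht
  have hfs : t ^ (j + l) = t ^ (j + l + 1) / t := by rw [pow_succ]; field_simp
  have hw : awNode a t j = a * t ^ j + (a * t ^ j)⁻¹ := rfl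
  rw [← hw] at key
  rw [hfs, awConnPred_succ h j (l + 1) (by omega)]
  rw [h.tNum_eq (by omega), awLower_eq h (by omega)] at r1 r2 ⊢
  rw [show a * b * c * d * t ^ (2 * j + 2 * l) =
        a * b * c * d * (t ^ (j + l + 1)) ^ 2 / t ^ 2 by field_simp; ring,
    show a * b * c * d * (t ^ (j + l + 1)) ^ 2 / t ^ 2 / t =
        a * b * c * d * (t ^ (j + l + 1)) ^ 2 / t ^ 3 by field_simp,
    show a * b * c * d * t ^ (2 * j + l) / t =
        a * b * c * d * t ^ (j + l + 1) * t ^ j / t ^ 2 by field_simp; ring, hfs] at r1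
  rw [show t ^ (2 * j + 2 * (l + 1)) = (t ^ (j + l + 1)) ^ 2 by ring,
    show a * b * c * d * t ^ (2 * j + (l + 1)) / t =
        a * b * c * d * t ^ (j + l + 1) * t ^ j / t by field_simp; ring,
    show t ^ (j + (l + 1) + 1) = t ^ (j + l + 1) * t by ring,
    show t ^ (l + 1) = t ^ l * t by ring,
    show l + 1 + 1 = l + 2 by omega, ← add_assoc] at r2
  rw [show a * b * c * d * t ^ (2 * j + (l + 1) + 1) / t ^ 3 =
        a * b * c * d * t ^ (j + l + 1) * t ^ j / t ^ 2 by field_simp; ring,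
    show l + 1 + 1 = l + 2 by omega, ← add_assoc]
  generalize t ^ (j + l + 1) = s at *
  generalize 1 - t ^ (l + 1) = N1 at *
  generalize 1 - t ^ (l + 2) = N2 at *
  generalize 1 - a * b * c * d * s ^ 2 / t ^ 3 = D3 at *
  generalize 1 - a * b * c * d * s ^ 2 / t ^ 2 = D2 at *
  generalize 1 - a * b * c * d * s ^ 2 / t = D1 at *
  generalize 1 - a * b * c * d * s ^ 2 = D0 at *
  generalize 1 - a * b * c * d * s * t ^ j / t ^ 2 = E at *
  generalize 1 - t = N0 at *
  rw [← eq_div_iff (by positivity)] at r1 r2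
  rw [show (1 - s * t) / N0 * t / (s * t) = (1 - s * t) / N0 / s by field_simp] at r2
  simp only [← mul_assoc _ s t, mul_div_cancel_right₀ _ ht] at r2
  -- Every coefficient is rewritten as a multiple of `awConn a b c d t j l`, which is never divided
  -- by since lowering coefficients may vanish.
  rw [← key, r2, r1, inv_div, div_div_eq_mul_div, ← div_eq_mul_inv, ← div_eq_mul_inv]
  generalize awNode a t j = w
  generalize g a b c d t s = G
  generalize (1 - s) / N0 * t / s * ((1 - a * b * s / t) * (1 - a * c * s / t) *
    (1 - a * d * s / t) / (a * s / t)) = H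
  generalize (1 - s * t) / N0 / s * ((1 - a * b * s) * (1 - a * c * s) *
    (1 - a * d * s) / (a * s)) = H1
  generalize (1 - t ^ j) / N0 * t / t ^ j * ((1 - a * b * t ^ j / t) * (1 - a * c * t ^ j / t) *
    (1 - a * d * t ^ j / t) / (a * t ^ j / t)) = H0
  generalize (1 - a * b * c * d * s * t ^ j / t) * (t ^ l * t) = K
  ring

theorem awPoly_add_two (h : Generic n a b c d t) (k : ℕ) (hn : k + 2 ≤ n) :
    awPoly a b c d t (k + 2) = (X + C (g a b c d t (t ^ (k + 1)))) * awPoly a b c d t (k + 1) -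
      C (f a b c d t (t ^ k)) * awPoly a b c d t k := by
  have hX : ∀ j, X * awBasis a t j = awBasis a t (j + 1) + C (awNode a t j) * awBasis a t j := by
    intro j; rw [awBasis_succ]; ring
  set G := g a b c d t (t ^ (k + 1))
  set F := f a b c d t (t ^ k)
  have S1 : (X + C G) * awPoly a b c d t (k + 1) =
      ∑ p ∈ Finset.HasAntidiagonal.antidiagonal (k + 2), C (awConnPred a b c d t p.1 p.2) * awBasis a t p.1 +
      ∑ p ∈ Finset.HasAntidiagonal.antidiagonal (k + 1), C ((awNode a t p.1 + G) * awConn a b c d t p.1 p.2) *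
        awBasis a t p.1 := by
    rw [Finset.Nat.sum_antidiagonal_succ]
    simp only [awConnPred, map_zero, zero_mul, zero_add]
    rw [← Finset.sum_add_distrib, awPoly, Finset.mul_sum]
    refine Finset.sum_congr rfl fun p _ => ?_
    rw [C_mul, C_add]
    linear_combination C (awConn a b c d t p.1 p.2) * hX p.1
  rw [S1]
  unfold awPoly
  rw [Finset.mul_sum]
  -- The two highest indices are split off: p_k contributes only to φ_j with j ≤ k, where the
  -- general recurrence applies.
  have T : ∀ u : ℕ × ℕ → ℂ[X], ∑ p ∈ Finset.HasAntidiagonal.antidiagonal (k + 2), u p =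
      u (k + 2, 0) + (u (k + 1, 1) + ∑ p ∈ Finset.HasAntidiagonal.antidiagonal k, u (p.1, p.2 + 2)) := by
    intro u
    rw [Finset.Nat.sum_antidiagonal_succ', Finset.Nat.sum_antidiagonal_succ']
  have T' : ∀ u : ℕ × ℕ → ℂ[X], ∑ p ∈ Finset.HasAntidiagonal.antidiagonal (k + 1), u p =
      u (k + 1, 0) + ∑ p ∈ Finset.HasAntidiagonal.antidiagonal k, u (p.1, p.2 + 1) := by
    intro u
    rw [Finset.Nat.sum_antidiagonal_succ']
  rw [T, T, T']
  have h1 := awConn_one_recurrence h (k + 1) (by omega)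
  have h2 : ∑ p ∈ Finset.HasAntidiagonal.antidiagonal k, C (awConn a b c d t p.1 (p.2 + 2)) * awBasis a t p.1 =
      ∑ p ∈ Finset.HasAntidiagonal.antidiagonal k, C (awConnPred a b c d t p.1 (p.2 + 2)) * awBasis a t p.1 +
      ∑ p ∈ Finset.HasAntidiagonal.antidiagonal k, C ((awNode a t p.1 + G) * awConn a b c d t p.1 (p.2 + 1)) *
        awBasis a t p.1 -
      ∑ p ∈ Finset.HasAntidiagonal.antidiagonal k, C F * (C (awConn a b c d t p.1 p.2) * awBasis a t p.1) := by
    rw [← Finset.sum_add_distrib, ← Finset.sum_sub_distrib]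
    refine Finset.sum_congr rfl fun p hp => ?_
    have hp' := Finset.HasAntidiagonal.mem_antidiagonal.1 hp
    rw [awConn_add_two_recurrence h p.1 p.2 (by omega), hp']
    simp only [C_add, C_sub, C_mul]
    ring
  simp only [h1, h2, awConn_zero, awConnPred, map_add, mul_one, map_one]
  ring

/-- The monic polynomials with three-term recurrence coefficients `-β k` and `γ k`. -/
noncomputable def orthPoly (β γ : ℕ → ℂ) : ℕ → ℂ[X]
  | 0 => 1
  | 1 => X + C (β 0)
  | k + 2 => (X + C (β (k + 1))) * orthPoly β γ (k + 1) - C (γ k) * orthPoly β γ k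

theorem awPoly_eq_orthPoly (h : Generic n a b c d t) (k : ℕ) (hn : k ≤ n) :
    awPoly a b c d t k =
      orthPoly (fun k => g a b c d t (t ^ k)) (fun k => f a b c d t (t ^ k)) k := by
  induction k using Nat.twoStepInduction with
  | zero => simp [awPoly, orthPoly, awConn_zero, awBasis]
  | one =>
    have := awConn_one_recurrence h 0 hn
    rw [awPoly, Finset.Nat.sum_antidiagonal_succ, orthPoly, this]
    simp [awConnPred, awConn_zero, awBasis]
    ring
  | more k ih1 ih2 =>
    rw [awPoly_add_two h k hn, ih1 (by omega), ih2 (by omega), orthPoly]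

end AskeyWilson

/-! ### Powers expanded in polynomials with a three-term recurrence -/

section Connection

variable (β γ : ℕ → ℂ)

theorem X_mul_orthPoly_zero : X * orthPoly β γ 0 = orthPoly β γ 1 - C (β 0) * orthPoly β γ 0 := by
  simp [orthPoly]

theorem X_mul_orthPoly_succ (k : ℕ) : X * orthPoly β γ (k + 1) =
    orthPoly β γ (k + 2) - C (β (k + 1)) * orthPoly β γ (k + 1) + C (γ k) * orthPoly β γ k := by
  rw [orthPoly]; ring

theorem orthPoly_monic_natDegree (k : ℕ) :
    (orthPoly β γ k).Monic ∧ (orthPoly β γ k).natDegree = k := by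
  induction k using Nat.twoStepInduction with
  | zero => simp [orthPoly]
  | one => exact ⟨monic_X_add_C _, natDegree_X_add_C _⟩
  | more k ih1 ih2 =>
    have hm : ((X + C (β (k + 1))) * orthPoly β γ (k + 1)).Monic := (monic_X_add_C _).mul ih2.1
    have hd : ((X + C (β (k + 1))) * orthPoly β γ (k + 1)).natDegree = k + 2 := by
      rw [(monic_X_add_C _).natDegree_mul ih2.1, natDegree_X_add_C, ih2.2]; ring
    have hlt : (C (γ k) * orthPoly β γ k).natDegree <
        ((X + C (β (k + 1))) * orthPoly β γ (k + 1)).natDegree := by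
      rw [hd]
      exact (natDegree_C_mul_le _ _).trans_lt (by omega)
    rw [orthPoly]
    refine ⟨hm.sub_of_left (degree_lt_degree hlt), ?_⟩
    rw [natDegree_sub_eq_left_of_natDegree_lt hlt, hd]

theorem natDegree_sum_orthPoly_lt (n : ℕ) (w : ℕ → ℂ) (hn : 0 < n) :
    (∑ k ∈ Finset.range n, C (w k) * orthPoly β γ k).natDegree < n := by
  rw [Nat.lt_iff_le_pred hn]
  refine natDegree_sum_le_of_forall_le _ _ fun k hk => ?_
  have := Finset.mem_range.1 hk
  refine (natDegree_C_mul_le _ _).trans ?_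
  rw [(orthPoly_monic_natDegree β γ k).2]
  omega

theorem eq_zero_of_sum_orthPoly_eq_zero (n : ℕ) (w : ℕ → ℂ)
    (h : ∑ k ∈ Finset.range n, C (w k) * orthPoly β γ k = 0) : ∀ k < n, w k = 0 := by
  induction n with
  | zero => intro k hk; omega
  | succ n ih =>
    have hn : w n = 0 := by
      have h1 := congrArg (fun p => coeff p n) h
      simp only [Finset.sum_range_succ, coeff_add, coeff_C_mul, coeff_zero] at h1
      have h2 : (orthPoly β γ n).coeff n = 1 := by
        have := (orthPoly_monic_natDegree β γ n).1.coeff_natDegree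
        rwa [(orthPoly_monic_natDegree β γ n).2] at this
      have h3 : (∑ k ∈ Finset.range n, C (w k) * orthPoly β γ k).coeff n = 0 := by
        rcases Nat.eq_zero_or_pos n with rfl | hpos
        · simp
        · exact coeff_eq_zero_of_natDegree_lt (natDegree_sum_orthPoly_lt β γ n w hpos)
      rw [h2, h3] at h1
      simpa using h1
    rw [Finset.sum_range_succ, hn] at h
    intro k hk
    rcases Nat.lt_succ_iff_lt_or_eq.1 hk with hk | rfl
    · exact ih (by simpa using h) k hk
    · exact hn

/-- The coefficients in the expansion of `X ^ k` in the polynomials `orthPoly β γ j`. -/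
noncomputable def connCoeff : ℕ → ℕ → ℂ
  | 0, 0 => 1
  | 0, _ + 1 => 0
  | k + 1, 0 => -β 0 * connCoeff k 0 + γ 0 * connCoeff k 1
  | k + 1, j + 1 =>
    connCoeff k j - β (j + 1) * connCoeff k (j + 1) + γ (j + 1) * connCoeff k (j + 2)

theorem connCoeff_eq_zero (k j : ℕ) (h : k < j) : connCoeff β γ k j = 0 := by
  induction k generalizing j with
  | zero => obtain ⟨j, rfl⟩ := Nat.exists_eq_add_of_lt h; simp [connCoeff]
  | succ k ih =>
    obtain ⟨j, rfl⟩ : ∃ i, j = i + 1 := ⟨j - 1, by omega⟩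
    rw [connCoeff, ih _ (by omega), ih _ (by omega), ih _ (by omega)]
    simp

theorem connCoeff_self (k : ℕ) : connCoeff β γ k k = 1 := by
  induction k with
  | zero => simp [connCoeff]
  | succ k ih =>
    rw [connCoeff, ih, connCoeff_eq_zero _ _ _ _ (by omega), connCoeff_eq_zero _ _ _ _ (by omega)]
    simp

theorem X_pow_eq_sum_orthPoly (k m : ℕ) (h : k < m) :
    (X : ℂ[X]) ^ k = ∑ j ∈ Finset.range m, C (connCoeff β γ k j) * orthPoly β γ j := by
  have ext : ∀ k m m' : ℕ, k < m → m ≤ m' →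
      ∑ j ∈ Finset.range m, C (connCoeff β γ k j) * orthPoly β γ j =
      ∑ j ∈ Finset.range m', C (connCoeff β γ k j) * orthPoly β γ j := by
    intro k m m' h1 h2
    refine Finset.sum_subset (Finset.range_mono h2) fun j _ hj => ?_
    rw [Finset.mem_range, not_lt] at hj
    rw [connCoeff_eq_zero _ _ _ _ (by omega)]; simp
  induction k generalizing m with
  | zero =>
    rw [← ext 0 1 m (by omega) (by omega)]
    simp [connCoeff, orthPoly]
  | succ k ih =>
    rw [ext _ m (m + 1) h (by omega), pow_succ', ih m (by omega), ext k m (m + 1) (by omega) (by omega),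
      Finset.mul_sum]
    have h1 : ∀ j, X * (C (connCoeff β γ k j) * orthPoly β γ j) =
        C (connCoeff β γ k j) * (X * orthPoly β γ j) := fun j => by ring
    simp only [h1]
    rw [Finset.sum_range_succ', X_mul_orthPoly_zero, Finset.sum_range_succ' (n := m)]
    simp only [X_mul_orthPoly_succ, connCoeff, C_add, C_sub, C_mul, C_neg]
    -- The shifted sums have equal length because the connection coefficients beyond degree k
    -- vanish.
    have s1 : ∑ j ∈ Finset.range m, C (connCoeff β γ k j) * orthPoly β γ (j + 1) =
        ∑ j ∈ Finset.range m, C (connCoeff β γ k (j + 1)) * orthPoly β γ (j + 2) +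
          C (connCoeff β γ k 0) * orthPoly β γ 1 := by
      have := Finset.sum_range_succ' (fun j => C (connCoeff β γ k j) * orthPoly β γ (j + 1)) m
      rw [Finset.sum_range_succ, connCoeff_eq_zero β γ k m (by omega)] at this
      simpa using this
    have s2 : ∑ j ∈ Finset.range m, C (γ j) * (C (connCoeff β γ k (j + 1)) * orthPoly β γ j) =
        ∑ j ∈ Finset.range m, C (γ (j + 1)) *
            (C (connCoeff β γ k (j + 2)) * orthPoly β γ (j + 1)) +
          C (γ 0) * (C (connCoeff β γ k 1) * orthPoly β γ 0) := by
      have := Finset.sum_range_succ'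
        (fun j => C (γ j) * (C (connCoeff β γ k (j + 1)) * orthPoly β γ j)) m
      rw [Finset.sum_range_succ, connCoeff_eq_zero β γ k (m + 1) (by omega)] at this
      simpa using this
    have s3 : ∀ j, C (connCoeff β γ k (j + 1)) * (orthPoly β γ (j + 2) -
        C (β (j + 1)) * orthPoly β γ (j + 1) + C (γ j) * orthPoly β γ j) =
        C (connCoeff β γ k (j + 1)) * orthPoly β γ (j + 2) -
        C (β (j + 1)) * (C (connCoeff β γ k (j + 1)) * orthPoly β γ (j + 1)) +
        C (γ j) * (C (connCoeff β γ k (j + 1)) * orthPoly β γ j) := fun j => by ring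
    have s4 : ∀ j, (C (connCoeff β γ k j) - C (β (j + 1)) * C (connCoeff β γ k (j + 1)) +
        C (γ (j + 1)) * C (connCoeff β γ k (j + 2))) * orthPoly β γ (j + 1) =
        C (connCoeff β γ k j) * orthPoly β γ (j + 1) -
        C (β (j + 1)) * (C (connCoeff β γ k (j + 1)) * orthPoly β γ (j + 1)) +
        C (γ (j + 1)) * (C (connCoeff β γ k (j + 2)) * orthPoly β γ (j + 1)) := fun j => by ring
    simp only [s3, s4, Finset.sum_add_distrib, Finset.sum_sub_distrib]
    rw [s1, s2]
    ring

end Connection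

/-! ### Elementary symmetric functions -/

section Elementary

/-- The elementary symmetric functions of `v 0, v 1, …`. -/
noncomputable def elem {n : ℕ} (v : Fin n → ℂ) (s : ℕ) : ℂ :=
  ∑ A ∈ Finset.powersetCard s Finset.univ, ∏ i ∈ A, v i

theorem coeff_prod_one_add {n : ℕ} (v : Fin n → ℂ) (s : ℕ) :
    (∏ i, (1 + C (v i) * X)).coeff s = elem v s := by
  rw [Finset.prod_one_add, finsetSum_coeff, elem, Finset.powersetCard_eq_filter,
    Finset.sum_filter]
  refine Finset.sum_congr rfl fun A _ => ?_
  rw [Finset.prod_mul_distrib, Finset.prod_const, ← map_prod, coeff_C_mul, coeff_X_pow]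
  simp [eq_comm]

theorem elem_zero {n : ℕ} (v : Fin n → ℂ) : elem v 0 = 1 := by simp [elem]

theorem elem_eq_zero {n : ℕ} (v : Fin n → ℂ) (s : ℕ) (h : n < s) : elem v s = 0 := by
  rw [elem, Finset.powersetCard_eq_empty.2 (by simpa using h), Finset.sum_empty]

theorem elem_succ {n : ℕ} (v : Fin (n + 1) → ℂ) (s : ℕ) :
    elem v (s + 1) = elem (Fin.init v) (s + 1) + v (Fin.last n) * elem (Fin.init v) s := by
  simp only [← coeff_prod_one_add]
  rw [Fin.prod_univ_castSucc, mul_add, mul_one, coeff_add]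
  congr 1
  rw [mul_left_comm, coeff_C_mul, coeff_mul_X]
  rfl

theorem prod_X_sub_C_eq_sum_elem {n : ℕ} (v : Fin n → ℂ) :
    ∏ i, (X - C (v i)) = ∑ s ∈ Finset.range (n + 1), C ((-1) ^ s * elem v s) * X ^ (n - s) := by
  have h : ∀ i, X - C (v i) = C (-v i) + X := fun i => by rw [C_neg]; ring
  simp only [h]
  rw [Finset.prod_add, Finset.sum_powerset, Finset.card_univ, Fintype.card_fin]
  refine Finset.sum_congr rfl fun s _ => ?_
  rw [elem, Finset.mul_sum, map_sum, Finset.sum_mul]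
  refine Finset.sum_congr rfl fun A hA => ?_
  rw [Finset.mem_powersetCard] at hA
  rw [← map_prod, Finset.prod_neg, Finset.prod_const, hA.2, ← Finset.compl_eq_univ_sdiff,
    Finset.card_compl, hA.2, Fintype.card_fin]

end Elementary

/-! ### Kernel coefficients and their recursion in the number of variables -/

section Expansion

variable (β γ : ℕ → ℂ)

/-- The coefficients in the expansion of `∏ i, (X - C (v i))` in the polynomials
`orthPoly β γ k`. -/
noncomputable def prodCoeff {n : ℕ} (v : Fin n → ℂ) (k : ℕ) : ℂ :=
  ∑ s ∈ Finset.range (n + 1), (-1) ^ s * elem v s * connCoeff β γ (n - s) k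

theorem prod_X_sub_C_eq_sum_orthPoly {n : ℕ} (v : Fin n → ℂ) :
    ∏ i, (X - C (v i)) =
      ∑ k ∈ Finset.range (n + 1), C (prodCoeff β γ v k) * orthPoly β γ k := by
  rw [prod_X_sub_C_eq_sum_elem]
  simp only [prodCoeff, map_sum, Finset.sum_mul]
  rw [Finset.sum_comm]
  refine Finset.sum_congr rfl fun s _ => ?_
  rw [X_pow_eq_sum_orthPoly β γ (n - s) (n + 1) (by omega), Finset.mul_sum]
  exact Finset.sum_congr rfl fun k _ => by simp only [C_mul]; ring

theorem prodCoeff_eq_zero {n : ℕ} (v : Fin n → ℂ) (k : ℕ) (h : n < k) :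
    prodCoeff β γ v k = 0 :=
  Finset.sum_eq_zero fun s _ => by rw [connCoeff_eq_zero _ _ _ _ (by omega), mul_zero]

theorem prodCoeff_self {n : ℕ} (v : Fin n → ℂ) : prodCoeff β γ v n = 1 := by
  rw [prodCoeff, Finset.sum_eq_single_of_mem 0 (by simp)]
  · simp [elem_zero, connCoeff_self]
  · intro s hs h0
    rw [connCoeff_eq_zero _ _ _ _ (by simp at hs; omega), mul_zero]

/-- Multiplication of the shorter product by X - v_last: raising the first index of `connCoeff` is
multiplication by X. -/
theorem prodCoeff_succ_eq {n : ℕ} (v : Fin (n + 1) → ℂ) (k : ℕ) :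
    prodCoeff β γ v k = ∑ s ∈ Finset.range (n + 1),
      (-1) ^ s * elem (Fin.init v) s * connCoeff β γ (n - s + 1) k -
      v (Fin.last n) * prodCoeff β γ (Fin.init v) k := by
  have e : ∀ s, n + 1 - (s + 1) = n - s := fun s => by omega
  rw [prodCoeff, Finset.sum_range_succ']
  simp only [elem_succ, e, elem_zero]
  have h1 := Finset.sum_range_succ' (fun s => (-1) ^ s * elem (Fin.init v) s *
    connCoeff β γ (n + 1 - s) k) (n + 1)
  rw [Finset.sum_range_succ, elem_eq_zero _ (n + 1) (by omega)] at h1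
  simp only [e, elem_zero, mul_zero, zero_mul, add_zero] at h1
  have h2 : ∑ s ∈ Finset.range (n + 1), (-1) ^ s * elem (Fin.init v) s *
      connCoeff β γ (n - s + 1) k = ∑ s ∈ Finset.range (n + 1), (-1) ^ s * elem (Fin.init v) s *
      connCoeff β γ (n + 1 - s) k := by
    refine Finset.sum_congr rfl fun s hs => ?_
    rw [show n + 1 - s = n - s + 1 by simp at hs; omega]
  rw [h2, h1, prodCoeff, Finset.mul_sum, add_sub_right_comm, ← Finset.sum_sub_distrib]
  congr 1
  exact Finset.sum_congr rfl fun s _ => by ring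

theorem prodCoeff_succ_zero {n : ℕ} (v : Fin (n + 1) → ℂ) :
    prodCoeff β γ v 0 = -(v (Fin.last n) + β 0) * prodCoeff β γ (Fin.init v) 0 +
      γ 0 * prodCoeff β γ (Fin.init v) 1 := by
  rw [prodCoeff_succ_eq]
  simp only [connCoeff, prodCoeff, Finset.mul_sum]
  rw [← Finset.sum_sub_distrib, ← Finset.sum_add_distrib]
  exact Finset.sum_congr rfl fun s _ => by ring

/-- The branching rule in disguise: three terms of the shorter expansion reach p_{k+1} after
multiplication by X - v_last. -/
theorem prodCoeff_succ_succ {n : ℕ} (v : Fin (n + 1) → ℂ) (k : ℕ) :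
    prodCoeff β γ v (k + 1) = prodCoeff β γ (Fin.init v) k -
      (v (Fin.last n) + β (k + 1)) * prodCoeff β γ (Fin.init v) (k + 1) +
      γ (k + 1) * prodCoeff β γ (Fin.init v) (k + 2) := by
  rw [prodCoeff_succ_eq]
  simp only [connCoeff, prodCoeff, Finset.mul_sum]
  rw [← Finset.sum_sub_distrib, ← Finset.sum_sub_distrib, ← Finset.sum_add_distrib]
  exact Finset.sum_congr rfl fun s _ => by ring

end Expansion

/-- The coordinates `x i + 1 / x i`. -/
noncomputable def symmCoord {n : ℕ} (x : Fin n → ℂ) (i : Fin n) : ℂ := x i + (x i)⁻¹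

/-! ### The Koornwinder operator applied to the kernel -/

section Operator

variable {n : ℕ} {a b c d q t : ℂ}

theorem koornwinderOp_sum {ι : Type*} (s : Finset ι) (w : ι → ℂ) (F : ι → (Fin n → ℂ) → ℂ)
    (x : Fin n → ℂ) :
    koornwinderOp a b c d q t (fun z => ∑ k ∈ s, w k * F k z) x =
      ∑ k ∈ s, w k * koornwinderOp a b c d q t (F k) x := by
  unfold koornwinderOp
  simp only [mul_add, Finset.mul_sum, Finset.sum_add_distrib, ← Finset.sum_sub_distrib]
  congr 1 <;>
  · rw [Finset.sum_comm]
    exact Finset.sum_congr rfl fun k _ => Finset.sum_congr rfl fun i _ => by ring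

theorem koornwinderOp_const_mul (w : ℂ) (F : (Fin n → ℂ) → ℂ) (x : Fin n → ℂ) :
    koornwinderOp a b c d q t (fun z => w * F z) x = w * koornwinderOp a b c d q t F x := by
  simpa using koornwinderOp_sum {()} (fun _ => w) (fun _ => F) x

theorem koornwinderOp_const (w : ℂ) (x : Fin n → ℂ) :
    koornwinderOp a b c d q t (fun _ => w) x = 0 := by
  simp [koornwinderOp]

theorem symmCoord_sub_ne {x : Fin n → ℂ} (hx : IsRegularPoint q x) {i j : Fin n} (h : i ≠ j) :
    symmCoord x i - symmCoord x j ≠ 0 := by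
  have hi := (hx.1 i).1
  have hj := (hx.1 j).1
  have e : symmCoord x i - symmCoord x j = (x i - x j) * (x i * x j - 1) / (x i * x j) := by
    unfold symmCoord; field_simp; ring
  rw [e]
  have h1 := sub_ne_zero.2 (hx.2 i j h).1
  have h2 := sub_ne_zero.2 (hx.2 i j h).2
  positivity

theorem divDiff_prod_X_sub_C (v : Fin n → ℂ) (i : Fin n) (u : ℂ) :
    divDiff u (v i) (∏ j, (X - C (v j))) = ∏ j ∈ Finset.univ.erase i, (u - v j) := by
  rw [divDiff, divByMonic_X_sub_C_eq (s := ∏ j ∈ Finset.univ.erase i, (X - C (v j))) (r := 0)]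
  · simp [eval_prod]
  · rw [← Finset.mul_prod_erase _ (fun j => X - C (v j)) (Finset.mem_univ i)]; simp

theorem prod_sub_symmCoord_update (x : Fin n → ℂ) (i : Fin n) (w : ℂ) :
    ∏ j, (symmCoord x i - symmCoord (Function.update x i w) j) =
      (symmCoord x i - (w + w⁻¹)) *
        ∏ j ∈ Finset.univ.erase i, (symmCoord x i - symmCoord x j) := by
  rw [← Finset.mul_prod_erase _ _ (Finset.mem_univ i)]
  congr 1
  · simp [symmCoord]
  · refine Finset.prod_congr rfl fun j hj => ?_
    simp [symmCoord, Function.update_of_ne (Finset.ne_of_mem_erase hj)]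

theorem prod_sub_symmCoord_update_of_ne (x : Fin n → ℂ) {i k : Fin n} (h : k ≠ i) (w : ℂ) :
    ∏ j, (symmCoord x i - symmCoord (Function.update x k w) j) = 0 :=
  Finset.prod_eq_zero (Finset.mem_univ i) (by simp [symmCoord, Function.update_of_ne h.symm])

/-- Since (1 - y x_j)(1 - y/x_j) = y (y + 1/y - s_j), and likewise with ty for y, the interaction
factor moves the kernel from y + 1/y to ty + 1/(ty). It is used for y = x_i and for y = 1/x_i. -/
theorem prod_interaction_mul {x : Fin n → ℂ} (ht : t ≠ 0) (i : Fin n) (y : ℂ) (hy : y ≠ 0)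
    (hyi : y + y⁻¹ = symmCoord x i) (hx : ∀ j, x j ≠ 0)
    (h : ∀ j, j ≠ i → symmCoord x i - symmCoord x j ≠ 0) :
    (∏ j ∈ Finset.univ.erase i,
        (1 - t * y * x j) * (1 - t * y / x j) / ((1 - y * x j) * (1 - y / x j))) *
      ∏ j ∈ Finset.univ.erase i, (symmCoord x i - symmCoord x j) =
    t ^ (n - 1) * ∏ j ∈ Finset.univ.erase i, (t * y + (t * y)⁻¹ - symmCoord x j) := by
  have hc : t ^ (n - 1) = ∏ _j ∈ Finset.univ.erase i, t := by simp
  rw [hc, ← Finset.prod_mul_distrib, ← Finset.prod_mul_distrib]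
  refine Finset.prod_congr rfl fun j hj => ?_
  have hs := h j (Finset.ne_of_mem_erase hj)
  have hxj := hx j
  have e : (1 - y * x j) * (1 - y / x j) = y * (symmCoord x i - symmCoord x j) := by
    rw [← hyi, symmCoord]; field_simp; ring
  rw [e]
  field_simp
  rw [symmCoord]; field_simp; ring

/-- At Y = s_i the kernel vanishes, and still vanishes after shifting any x_k with k ≠ i. The two
remaining terms are divided differences of the kernel in Y, because Y = s_i is one of its roots. -/
theorem koornwinderOp_prod (hq : q ≠ 0) (ht : t ≠ 0) (hα : alpha a b c d q ≠ 0)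
    {x : Fin n → ℂ} (hx : IsRegularPoint q x) (i : Fin n) :
    koornwinderOp a b c d q t (fun z => ∏ j, (symmCoord x i - symmCoord z j)) x =
      -((1 - q) / (q * alpha a b c d q)) *
        awOp a b c d t (x i) (∏ j, (X - C (symmCoord x j))) := by
  have h0 : ∏ j, (symmCoord x i - symmCoord x j) = 0 :=
    Finset.prod_eq_zero (Finset.mem_univ i) (sub_self _)
  have hxi := (hx.1 i).1
  have hx0 : ∀ j, x j ≠ 0 := fun j => (hx.1 j).1
  have hs : ∀ j, j ≠ i → symmCoord x i - symmCoord x j ≠ 0 :=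
    fun j hj => symmCoord_sub_ne hx hj.symm
  have p1 := prod_interaction_mul ht i (x i) hxi rfl hx0 hs
  have p2 := prod_interaction_mul ht i (x i)⁻¹ (inv_ne_zero hxi)
    (by rw [inv_inv, add_comm]; rfl) hx0 hs
  have e2 : ∏ j ∈ Finset.univ.erase i, (1 - t * x j / x i) * (1 - t / (x i * x j)) /
      ((1 - x j / x i) * (1 - 1 / (x i * x j))) = ∏ j ∈ Finset.univ.erase i,
      (1 - t * (x i)⁻¹ * x j) * (1 - t * (x i)⁻¹ / x j) /
        ((1 - (x i)⁻¹ * x j) * (1 - (x i)⁻¹ / x j)) := by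
    refine Finset.prod_congr rfl fun j _ => ?_
    have := hx0 j
    congr 1 <;> congr 1 <;> congr 1 <;> field_simp
  unfold koornwinderOp
  simp only [h0, sub_zero]
  rw [Finset.sum_eq_single i (fun k _ hk => by
      rw [prod_sub_symmCoord_update_of_ne x hk, mul_zero]) (by simp),
    Finset.sum_eq_single i (fun k _ hk => by
      rw [prod_sub_symmCoord_update_of_ne x hk, mul_zero]) (by simp),
    prod_sub_symmCoord_update, prod_sub_symmCoord_update, e2, awOp]
  have d1 : ∀ u, divDiff u (x i + (x i)⁻¹) (∏ j, (X - C (symmCoord x j))) = _ :=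
    fun u => divDiff_prod_X_sub_C (symmCoord x) i u
  rw [d1, d1]
  have hn : t ^ (n - 1) ≠ 0 := pow_ne_zero _ ht
  have hα' := hα
  generalize alpha a b c d q = α at hα' ⊢
  generalize ∏ j ∈ Finset.univ.erase i, (symmCoord x i - symmCoord x j) = V at p1 p2 ⊢
  have r1 := sub_ne_zero.2 (hx.1 i).2.1
  have r2 := sub_ne_zero.2 (hx.1 i).2.2.1
  have r3 := sub_ne_zero.2 (hx.1 i).2.2.2
  have r1' : 1 - x i ^ 2 ≠ 0 := by rw [← neg_sub]; exact neg_ne_zero.2 r1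
  have r2' : 1 - q * x i ^ 2 ≠ 0 := by rw [← neg_sub]; exact neg_ne_zero.2 r2
  -- The factor of the kernel created by the q-shift cancels the denominator containing q, so that q
  -- and α enter only through a scalar.
  have c1 : symmCoord x i - (q * x i + (q * x i)⁻¹) =
      -((1 - q) / (q * x i)) * (1 - q * x i ^ 2) := by
    unfold symmCoord; field_simp; ring
  have c2 : symmCoord x i - (q⁻¹ * x i + (q⁻¹ * x i)⁻¹) =
      -((1 - q) * x i / q) * (1 - q / x i ^ 2) := by
    unfold symmCoord; field_simp; ring
  have r3' : 1 - q / x i ^ 2 ≠ 0 := by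
    rw [one_sub_div (pow_ne_zero _ hxi)]; positivity
  have r4' : 1 - 1 / x i ^ 2 ≠ 0 := by
    rw [one_sub_div (pow_ne_zero _ hxi)]; positivity
  rw [c1, c2]
  have w1 : (1 - a * x i) * (1 - b * x i) * (1 - c * x i) * (1 - d * x i) /
      (α * t ^ (n - 1) * (1 - x i ^ 2) * (1 - q * x i ^ 2)) *
      (-((1 - q) / (q * x i)) * (1 - q * x i ^ 2)) =
      -((1 - q) / (q * α)) * awCoeff a b c d (x i) / t ^ (n - 1) := by
    unfold awCoeff
    generalize 1 - q * x i ^ 2 = R at *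
    generalize 1 - x i ^ 2 = R' at *
    field_simp
  have w2 : (1 - a / x i) * (1 - b / x i) * (1 - c / x i) * (1 - d / x i) /
      (α * t ^ (n - 1) * (1 - 1 / x i ^ 2) * (1 - q / x i ^ 2)) *
      (-((1 - q) * x i / q) * (1 - q / x i ^ 2)) =
      -((1 - q) / (q * α)) * awCoeff a b c d (x i)⁻¹ / t ^ (n - 1) := by
    unfold awCoeff
    simp only [← div_eq_mul_inv, inv_pow, ← one_div (x i ^ 2)]
    generalize 1 - 1 / x i ^ 2 = R at *
    generalize 1 - q / x i ^ 2 = R at *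
    field_simp
  generalize (1 - a * x i) * (1 - b * x i) * (1 - c * x i) * (1 - d * x i) /
      (α * t ^ (n - 1) * (1 - x i ^ 2) * (1 - q * x i ^ 2)) = A1 at *
  generalize (1 - a / x i) * (1 - b / x i) * (1 - c / x i) * (1 - d / x i) /
      (α * t ^ (n - 1) * (1 - 1 / x i ^ 2) * (1 - q / x i ^ 2)) = A2 at *
  rw [mul_mul_mul_comm, w1, p1, mul_mul_mul_comm, w2, p2]
  field_simp
  ring

end Operator

/-! ### Kernel coefficients as eigenfunctions -/

section Eigen

variable {m n : ℕ} {a b c d q t : ℂ}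

/-- Besides nonvanishing, this is all that is used about α, so the branch of the root is immaterial.
-/
theorem alpha_mul_self (h : a * b * c * d / q ≠ 0) :
    alpha a b c d q * alpha a b c d q = a * b * c * d / q := by
  unfold alpha
  rw [← Complex.cpow_add _ _ h]
  norm_num

theorem alpha_ne_zero (h : a * b * c * d / q ≠ 0) : alpha a b c d q ≠ 0 := by
  intro h0
  have := alpha_mul_self h
  rw [h0, zero_mul] at this
  exact h this.symm

/-- The coefficients `g (t ^ k)` of the three-term recurrence. -/
noncomputable def gSeq (a b c d t : ℂ) (k : ℕ) : ℂ := g a b c d t (t ^ k)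

/-- The coefficients `f (t ^ k)` of the three-term recurrence. -/
noncomputable def fSeq (a b c d t : ℂ) (k : ℕ) : ℂ := f a b c d t (t ^ k)

theorem awOp_orthPoly (h : Generic m a b c d t) (k : ℕ) (hk : k ≤ m) {y : ℂ} (hy : y ≠ 0)
    (hy2 : y ^ 2 ≠ 1) :
    awOp a b c d t y (orthPoly (gSeq a b c d t) (fSeq a b c d t) k) =
      awEigen (a * b * c * d) t k *
        (orthPoly (gSeq a b c d t) (fSeq a b c d t) k).eval (y + y⁻¹) := by
  have e : orthPoly (gSeq a b c d t) (fSeq a b c d t) k = awPoly a b c d t k :=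
    (awPoly_eq_orthPoly h k hk).symm
  rw [e]
  exact awOp_awPoly h k hk hy hy2

/-- The defects G k are the coefficients, in the basis p_k, of a polynomial of degree below n that
vanishes at the n distinct points s_i. -/
theorem koornwinderOp_prodCoeff (h : Generic m a b c d t) (hn : n ≤ m) (hq : q ≠ 0)
    (hα : alpha a b c d q ≠ 0) {x : Fin n → ℂ} (hx : IsRegularPoint q x) (k : ℕ) (hk : k ≤ n) :
    koornwinderOp a b c d q t
        (fun z => prodCoeff (gSeq a b c d t) (fSeq a b c d t) (symmCoord z) k) x =
      (1 - q) / (q * alpha a b c d q) *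
        (awEigen (a * b * c * d) t n - awEigen (a * b * c * d) t k) *
        prodCoeff (gSeq a b c d t) (fSeq a b c d t) (symmCoord x) k := by
  set β := gSeq a b c d t
  set γ := fSeq a b c d t
  set κ := (1 - q) / (q * alpha a b c d q)
  set e := awEigen (a * b * c * d) t
  set G : ℕ → ℂ := fun k => koornwinderOp a b c d q t
      (fun z => prodCoeff β γ (symmCoord z) k) x -
    κ * (e n - e k) * prodCoeff β γ (symmCoord x) k with hG
  -- The top coefficient is the constant 1, which the operator kills; this is why the eigenvalues
  -- are normalized by subtracting from e n.
  have hGn : G n = 0 := by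
    simp only [hG, prodCoeff_self, koornwinderOp_const, sub_self, mul_zero, zero_mul]
  have hprod : ∀ (z : Fin n → ℂ) (Y : ℂ), ∏ j, (Y - symmCoord z j) =
      ∑ k ∈ Finset.range (n + 1), (orthPoly β γ k).eval Y * prodCoeff β γ (symmCoord z) k := by
    intro z Y
    have := congrArg (eval Y) (prod_X_sub_C_eq_sum_orthPoly β γ (symmCoord z))
    simp only [eval_prod, eval_sub, eval_X, eval_C, eval_finsetSum, eval_mul] at this
    rw [this]
    exact Finset.sum_congr rfl fun k _ => mul_comm _ _
  have hroot : ∀ i, (∑ k ∈ Finset.range n, C (G k) * orthPoly β γ k).eval (symmCoord x i) = 0 := by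
    intro i
    have h1 := koornwinderOp_prod hq h.t_ne hα hx i
    simp only [hprod] at h1
    rw [koornwinderOp_sum, prod_X_sub_C_eq_sum_orthPoly β γ (symmCoord x), awOp_sum] at h1
    have h2 : ∀ k ∈ Finset.range (n + 1), awOp a b c d t (x i)
        (C (prodCoeff β γ (symmCoord x) k) * orthPoly β γ k) =
        prodCoeff β γ (symmCoord x) k * (e k * (orthPoly β γ k).eval (symmCoord x i)) := by
      intro k hk
      rw [Finset.mem_range] at hk
      rw [awOp_C_mul, awOp_orthPoly h k (by omega) (hx.1 i).1 (hx.1 i).2.1]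
      rfl
    rw [Finset.sum_congr rfl h2] at h1
    have h3 := hprod x (symmCoord x i)
    rw [Finset.prod_eq_zero (Finset.mem_univ i) (sub_self _)] at h3
    have h4 : (∑ k ∈ Finset.range n, C (G k) * orthPoly β γ k).eval (symmCoord x i) =
        ∑ k ∈ Finset.range (n + 1), G k * (orthPoly β γ k).eval (symmCoord x i) := by
      rw [Finset.sum_range_succ, hGn]
      simp [eval_finsetSum]
    rw [h4]
    -- The e n part may be added freely, since it multiplies the value of the kernel at s_i, which
    -- is zero.
    have h5 : ∀ k, G k * (orthPoly β γ k).eval (symmCoord x i) =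
        (orthPoly β γ k).eval (symmCoord x i) * koornwinderOp a b c d q t
          (fun z => prodCoeff β γ (symmCoord z) k) x -
        κ * e n * ((orthPoly β γ k).eval (symmCoord x i) * prodCoeff β γ (symmCoord x) k) +
        κ * (prodCoeff β γ (symmCoord x) k * (e k * (orthPoly β γ k).eval (symmCoord x i))) := by
      intro k; simp only [hG]; ring
    simp only [h5]
    rw [Finset.sum_add_distrib, Finset.sum_sub_distrib, ← Finset.mul_sum, ← Finset.mul_sum, ← h3,
      h1]
    ring
  have hinj : Function.Injective (symmCoord x) := by
    intro i j hij
    by_contra hne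
    exact symmCoord_sub_ne hx hne (sub_eq_zero.2 hij)
  have hzero : ∀ k < n, G k = 0 := by
    rcases Nat.eq_zero_or_pos n with rfl | hpos
    · intro k hk; omega
    · refine eq_zero_of_sum_orthPoly_eq_zero β γ n G ?_
      refine eq_zero_of_natDegree_lt_card_of_eval_eq_zero _ hinj hroot ?_
      rw [Fintype.card_fin]
      exact natDegree_sum_orthPoly_lt β γ n G hpos
  have : G k = 0 := by
    rcases hk.lt_or_eq with hk | rfl
    · exact hzero k hk
    · exact hGn
  exact sub_eq_zero.1 this

/-- As α²q = abcd, each of the first r brackets is a scalar times a difference of consecutive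
Askey-Wilson eigenvalues, and the sum telescopes. -/
theorem eigenvalue_column (hB : a * b * c * d / q ≠ 0) (hq : q ≠ 0) (ht : t ≠ 0) (r : ℕ)
    (hr : r ≤ n) :
    eigenvalue a b c d q t (column n r) = (1 - q) / (q * alpha a b c d q) *
      (awEigen (a * b * c * d) t n - awEigen (a * b * c * d) t (n - r)) := by
  have hα := alpha_ne_zero hB
  have hαα := alpha_mul_self hB
  rw [eq_div_iff hq] at hαα
  have h0 : ∀ y, bracket y y = 0 := fun y => by unfold bracket; ring
  unfold eigenvalue column
  rw [Fin.sum_univ_eq_sum_range (fun j => bracket (alpha a b c d q * t ^ (n - 1 - j) *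
    q ^ (if j < r then 1 else 0)) (alpha a b c d q * t ^ (n - 1 - j)))]
  rw [← Finset.sum_subset (Finset.range_mono hr) (fun j _ hj => by
    rw [Finset.mem_range] at hj
    rw [if_neg hj, pow_zero, mul_one, h0])]
  have := Finset.sum_range_sub' (fun j => awEigen (a * b * c * d) t (n - j)) r
  rw [Nat.sub_zero] at this
  rw [← this, Finset.mul_sum]
  refine Finset.sum_congr rfl fun j hj => ?_
  rw [Finset.mem_range] at hj
  have e := awEigen_sub (B := a * b * c * d) ht (n - 1 - j) 1
  rw [show n - 1 - j + 1 = n - j by omega, show n - 1 - j = n - (j + 1) by omega] at e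
  rw [e, if_pos hj, show n - 1 - j = n - (j + 1) by omega, ← hαα]
  have e1 : t ^ (n - j) = t ^ (n - (j + 1)) * t := by
    rw [← pow_succ]; congr 1; omega
  have e2 : t ^ (2 * (n - (j + 1)) + 1) / t = (t ^ (n - (j + 1))) ^ 2 := by
    rw [pow_succ, mul_div_cancel_right₀ _ ht]; ring
  have hT : t ^ (n - (j + 1)) ≠ 0 := pow_ne_zero _ ht
  rw [mul_div_assoc (alpha a b c d q * alpha a b c d q * q), e2, e1]
  have n1 : tNum t 1 = 1 := by simp [tNum]
  rw [n1]
  unfold bracket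
  field_simp
  ring

end Eigen

/-! ### Evaluation of orbit sums of columns -/

section Eval

variable {n : ℕ}

theorem Laurent.eval_add (P R : Laurent n) (x : Fin n → ℂ) :
    (P + R).eval x = P.eval x + R.eval x := by
  unfold Laurent.eval
  rw [AddMonoidAlgebra.coeff_add]
  exact Finsupp.sum_add_index' (fun _ => zero_mul _) (fun _ _ _ => add_mul _ _ _)

theorem Laurent.eval_smul (w : ℂ) (P : Laurent n) (x : Fin n → ℂ) :
    (w • P).eval x = w * P.eval x := by
  unfold Laurent.eval
  rw [AddMonoidAlgebra.coeff_smul, Finsupp.sum_smul_index (fun _ => zero_mul _), Finsupp.mul_sum]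
  simp only [mul_assoc]

/-- Evaluation of Laurent polynomials at a point as a linear map. -/
noncomputable def Laurent.evalₗ (x : Fin n → ℂ) : Laurent n →ₗ[ℂ] ℂ where
  toFun P := P.eval x
  map_add' P R := Laurent.eval_add P R x
  map_smul' w P := Laurent.eval_smul w P x

theorem Laurent.eval_sum {ι : Type*} (s : Finset ι) (P : ι → Laurent n) (x : Fin n → ℂ) :
    (∑ k ∈ s, P k).eval x = ∑ k ∈ s, (P k).eval x := map_sum (Laurent.evalₗ x) P s

theorem Laurent.eval_single (μ : Fin n → ℤ) (x : Fin n → ℂ) :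
    Laurent.eval (AddMonoidAlgebra.single μ (1 : ℂ)) x = ∏ i, x i ^ μ i := by
  unfold Laurent.eval
  rw [AddMonoidAlgebra.coeff_single, Finsupp.sum_single_index (zero_mul _), one_mul]

theorem sum_column (n s : ℕ) (h : s ≤ n) : ∑ i, column n s i = s := by
  unfold column
  rw [Fin.sum_univ_eq_sum_range (fun j => if j < s then 1 else 0), Finset.sum_ite]
  have : (Finset.range n).filter (· < s) = Finset.range s := by
    ext; simp; omega
  simp [this]

theorem signedOrbit_column (s : ℕ) (h : s ≤ n) :
    signedOrbit (column n s) = (Fintype.piFinset fun _ : Fin n => ({-1, 0, 1} : Finset ℤ)).filter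
      fun μ => ∑ i, (μ i).natAbs = s := by
  ext μ
  simp only [signedOrbit, Finset.mem_image, Finset.mem_univ, true_and, Finset.mem_filter,
    Fintype.mem_piFinset]
  constructor
  · rintro ⟨⟨w, σ⟩, rfl⟩
    refine ⟨fun i => ?_, ?_⟩
    · rcases Int.units_eq_one_or (w i) with hw | hw <;> by_cases hc : ((σ i : Fin n) : ℕ) < s <;>
        simp [hw, column, hc]
    · have : ∀ i, (((w i : ℤˣ) : ℤ) * (column n s (σ i) : ℤ)).natAbs = column n s (σ i) := by
        intro i
        rw [Int.natAbs_mul, Int.units_natAbs]; simp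
      simp only [this]
      rw [Equiv.sum_comp σ (column n s), sum_column n s h]
  · rintro ⟨h1, h2⟩
    have hcard : Fintype.card {i // μ i ≠ 0} = Fintype.card {i : Fin n // (i : ℕ) < s} := by
      rw [Fintype.card_subtype, Fintype.card_subtype]
      have e1 : ∑ i, (μ i).natAbs = (Finset.univ.filter fun i => μ i ≠ 0).card := by
        rw [Finset.card_filter]
        refine Finset.sum_congr rfl fun i _ => ?_
        have := h1 i
        simp only [Finset.mem_insert, Finset.mem_singleton] at this
        rcases this with h | h | h <;> simp [h]
      have e2 := sum_column n s h
      unfold column at e2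
      rw [← Finset.card_filter] at e2
      rw [← e1, h2, e2]
    -- A bijection from the support of μ to the first s positions, extended to a permutation, places
    -- the ones; the signs are read off from μ.
    let e := Fintype.equivOfCardEq hcard
    refine ⟨(fun i => if μ i = -1 then -1 else 1, e.extendSubtype), funext fun i => ?_⟩
    by_cases h0 : μ i = 0
    · have : ¬ ((e.extendSubtype i : Fin n) : ℕ) < s :=
        e.extendSubtype_not_mem i (by simpa using h0)
      simp [column, this, h0]
    · have h3 : ((e.extendSubtype i : Fin n) : ℕ) < s := e.extendSubtype_mem i h0
      have := h1 i
      simp only [Finset.mem_insert, Finset.mem_singleton] at this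
      rcases this with h | h | h
      · simp [column, h3, h]
      · exact absurd h h0
      · simp [column, h3, h]

/-- Both sides are the coefficient of X^s in ∏ (1 + (x_i + 1/x_i) X), where each factor is the sum
of x_i^m X^|m| over m in {-1, 0, 1}. -/
theorem eval_monomialSymm_column (s : ℕ) (h : s ≤ n) {x : Fin n → ℂ} :
    (monomialSymm (column n s)).eval x = elem (symmCoord x) s := by
  rw [monomialSymm, Laurent.eval_sum, signedOrbit_column s h, ← coeff_prod_one_add]
  simp only [Laurent.eval_single]
  have e : ∀ i, (1 + C (symmCoord x i) * X : ℂ[X]) =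
      ∑ m ∈ ({-1, 0, 1} : Finset ℤ), C (x i ^ m) * X ^ m.natAbs := by
    intro i
    rw [Finset.sum_insert (by decide), Finset.sum_insert (by decide), Finset.sum_singleton]
    simp [symmCoord]
    ring
  simp only [e]
  rw [Finset.prod_univ_sum, finsetSum_coeff, Finset.sum_filter]
  refine Finset.sum_congr rfl fun μ _ => ?_
  rw [Finset.prod_mul_distrib, Finset.prod_pow_eq_pow_sum, ← map_prod, coeff_C_mul, coeff_X_pow]
  simp [eq_comm]

end Eval

/-! ### Partitions below a column -/

section Dominance

variable {n : ℕ}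

theorem antitone_column (r : ℕ) : Antitone (column n r) := by
  intro i j hij
  unfold column
  have : (i : ℕ) ≤ j := hij
  split_ifs <;> omega

theorem eq_of_column_eq {r s : ℕ} (hr : r ≤ n) (hs : s ≤ n) (h : column n r = column n s) : r = s := by
  rw [← sum_column n r hr, ← sum_column n s hs, h]

/-- The first partial sum bounds all parts by 1, so μ is itself a column; more than r ones would
violate the partial sum of length r + 1. -/
theorem exists_eq_column {μ : Fin n → ℕ} {r : ℕ} (hμ : Antitone μ)
    (hd : DominanceLE μ (column n r)) (hne : μ ≠ column n r) (hr : r ≤ n) :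
    ∃ s < r, μ = column n s := by
  have hle : ∀ i, μ i ≤ 1 := by
    intro i
    have hpos : 0 < n := i.pos
    have h0 := hd ⟨0, hpos⟩
    have e : Finset.Iic (⟨0, hpos⟩ : Fin n) = {⟨0, hpos⟩} := by
      ext j; simp [Fin.le_def, Fin.ext_iff]
    rw [e, Finset.sum_singleton, Finset.sum_singleton] at h0
    refine (hμ (show (⟨0, hpos⟩ : Fin n) ≤ i from Nat.zero_le _)).trans (h0.trans ?_)
    unfold column; split_ifs <;> omega
  have hex : ∃ s, ∀ i : Fin n, s ≤ (i : ℕ) → μ i = 0 := ⟨n, fun i hi => absurd i.2 (by omega)⟩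
  classical
  let s := Nat.find hex
  have hs1 : ∀ i : Fin n, s ≤ (i : ℕ) → μ i = 0 := Nat.find_spec hex
  have hs2 : ∀ i : Fin n, (i : ℕ) < s → μ i = 1 := by
    intro i hi
    have := Nat.find_min hex hi
    push Not at this
    obtain ⟨j, hj1, hj2⟩ := this
    have h1 : μ j ≤ μ i := hμ (show i ≤ j from hj1)
    have := hle i
    omega
  have hμs : μ = column n s := by
    funext i
    unfold column
    split_ifs with h
    · exact hs2 i h
    · exact hs1 i (by omega)
  refine ⟨s, ?_, hμs⟩
  by_contra hlt
  have hne' : s ≠ r := fun h => hne (h ▸ hμs)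
  have hrs : r < s := by omega
  have hsn : s ≤ n := by
    refine Nat.find_min' hex fun i hi => absurd i.2 (by omega)
  have := hd ⟨r, by omega⟩
  have e1 : ∑ i ∈ Finset.Iic (⟨r, by omega⟩ : Fin n), μ i = r + 1 := by
    rw [Finset.sum_congr rfl (g := fun _ => 1) fun i hi => ?_]
    · simp
    · rw [Finset.mem_Iic, Fin.le_def] at hi
      exact hs2 i (by simp at hi; omega)
  have e2 : ∑ i ∈ Finset.Iic (⟨r, by omega⟩ : Fin n), column n r i ≤ r :=
    (Finset.sum_le_sum_of_subset (Finset.subset_univ _)).trans (sum_column n r hr).le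
  omega

theorem dominanceLE_column {r s : ℕ} (h : s ≤ r) : DominanceLE (column n s) (column n r) := by
  intro k
  refine Finset.sum_le_sum fun i _ => ?_
  unfold column
  split_ifs <;> omega

theorem triangular_iff (r : ℕ) (hr : r ≤ n) (R : Laurent n) :
    R ∈ Submodule.span ℂ {m : Laurent n | ∃ μ : Fin n → ℕ, Antitone μ ∧
        DominanceLE μ (column n r) ∧ μ ≠ column n r ∧ m = monomialSymm μ} ↔
      ∃ w : ℕ → ℂ, R = ∑ s ∈ Finset.range r, w s • monomialSymm (column n s) := by
  have e : {m : Laurent n | ∃ μ : Fin n → ℕ, Antitone μ ∧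
      DominanceLE μ (column n r) ∧ μ ≠ column n r ∧ m = monomialSymm μ} =
      (fun s => monomialSymm (column n s)) '' (Finset.range r : Set ℕ) := by
    ext m
    constructor
    · rintro ⟨μ, h1, h2, h3, rfl⟩
      obtain ⟨s, hs, rfl⟩ := exists_eq_column h1 h2 h3 hr
      exact ⟨s, by simpa using hs, rfl⟩
    · rintro ⟨s, hs, rfl⟩
      have hs : s < r := by simpa using hs
      refine ⟨column n s, antitone_column s, dominanceLE_column hs.le, fun h => ?_, rfl⟩
      have := eq_of_column_eq (by omega) hr h
      omega
  rw [e, Submodule.mem_span_image_finset_iff_exists_fun']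
  constructor <;> rintro ⟨w, hw⟩ <;> exact ⟨w, hw.symm⟩

end Dominance

/-! ### Independence on regular points -/

section Independence

/-- A combination of elementary symmetric functions is affine in each variable, so vanishing on a
grid with two values per coordinate forces it to be zero. Varying the last coordinate separates the
two coefficients. -/
theorem eq_zero_of_sum_elem_eq_zero {n : ℕ} (p : Fin n → Bool → ℂ)
    (hp : ∀ i, p i false ≠ p i true) (w : ℕ → ℂ)
    (h : ∀ ε : Fin n → Bool,
      ∑ s ∈ Finset.range (n + 1), w s * elem (fun i => p i (ε i)) s = 0) :
    ∀ s ≤ n, w s = 0 := by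
  induction n generalizing w with
  | zero =>
    intro s hs
    obtain rfl : s = 0 := by omega
    simpa [elem_zero] using h fun _ => false
  | succ n ih =>
    have key : ∀ (ε : Fin n → Bool) (δ : Bool),
        ∑ s ∈ Finset.range (n + 1), w s * elem (fun i => p i.castSucc (ε i)) s +
        p (Fin.last n) δ * ∑ s ∈ Finset.range (n + 1),
          w (s + 1) * elem (fun i => p i.castSucc (ε i)) s = 0 := by
      intro ε δ
      have h1 := h (Fin.snoc (α := fun _ => Bool) ε δ)
      set v : Fin (n + 1) → ℂ := fun i => p i (Fin.snoc (α := fun _ => Bool) ε δ i) with hv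
      have hlast : v (Fin.last n) = p (Fin.last n) δ := by simp [hv]
      have hinit : Fin.init v = fun i => p i.castSucc (ε i) := by
        funext i; simp [hv, Fin.init]
      rw [Finset.sum_range_succ'] at h1
      simp only [elem_succ, hlast, hinit, elem_zero] at h1
      have h2 := Finset.sum_range_succ'
        (fun s => w s * elem (fun i => p (Fin.castSucc i) (ε i)) s) (n + 1)
      rw [Finset.sum_range_succ, elem_eq_zero _ (n + 1) (by omega)] at h2
      simp only [elem_zero, mul_zero, add_zero] at h2
      rw [h2, Finset.mul_sum, ← h1, add_right_comm, ← Finset.sum_add_distrib]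
      congr 1
      exact Finset.sum_congr rfl fun s _ => by ring
    have hsucc : ∀ s ≤ n, w (s + 1) = 0 := by
      refine ih (fun i => p i.castSucc) (fun i => hp _) (fun s => w (s + 1)) fun ε => ?_
      have h1 := key ε false
      have h2 := key ε true
      have h3 : (p (Fin.last n) false - p (Fin.last n) true) * ∑ s ∈ Finset.range (n + 1),
          w (s + 1) * elem (fun i => p i.castSucc (ε i)) s = 0 := by
        linear_combination h1 - h2
      exact (mul_eq_zero.1 h3).resolve_left (sub_ne_zero.2 (hp _))
    have hzero : ∀ s ≤ n, w s = 0 := by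
      refine ih (fun i => p i.castSucc) (fun i => hp _) w fun ε => ?_
      have h1 := key ε false
      rwa [Finset.sum_eq_zero (s := Finset.range (n + 1))
        (f := fun s => w (s + 1) * elem (fun i => p i.castSucc (ε i)) s) (fun s hs => by
          rw [hsucc s (by simpa [Nat.lt_succ_iff] using hs), zero_mul]), mul_zero, add_zero] at h1
    intro s hs
    rcases hs.lt_or_eq with hs | rfl
    · exact hzero s (by omega)
    · exact hsucc n le_rfl

/-- For `|q| < 1` there is a product of two-element sets of regular points. -/
theorem exists_regular_family (n : ℕ) {q : ℂ} (hq0 : q ≠ 0) (hq1 : ‖q‖ < 1) :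
    ∃ p : Fin n → Bool → ℂ, (∀ i, p i false + (p i false)⁻¹ ≠ p i true + (p i true)⁻¹) ∧
      ∀ ε : Fin n → Bool, IsRegularPoint q fun i => p i (ε i) := by
  have hq : 0 < ‖q‖ := norm_pos_iff.2 hq0
  -- With this ρ all points ρ·2^e have modulus above 1 and |q|ρ > 1, so no excluded product or
  -- square relation can hold; distinct exponents 2i + δ keep the points apart.
  set ρ : ℝ := 1 + ‖q‖⁻¹ with hρ
  have hqi : 0 < ‖q‖⁻¹ := inv_pos.2 hq
  have hρ1 : 1 < ρ := by linarith
  let e : ℕ → Bool → ℕ := fun i δ => 2 * i + δ.toNat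
  let p : Fin n → Bool → ℂ := fun i δ => ((ρ * 2 ^ e i δ : ℝ) : ℂ)
  have hnorm : ∀ i δ, ‖p i δ‖ = ρ * 2 ^ e i δ := by
    intro i δ
    rw [Complex.norm_real, Real.norm_of_nonneg (by positivity)]
  have hge : ∀ i δ, ρ ≤ ‖p i δ‖ := by
    intro i δ
    rw [hnorm]
    exact le_mul_of_one_le_right (by linarith) (one_le_pow₀ (by norm_num))
  have hne0 : ∀ i δ, p i δ ≠ 0 := fun i δ => norm_pos_iff.1 (by linarith [hge i δ])
  have hmul : ∀ i δ j δ', 1 < ‖p i δ * p j δ'‖ := by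
    intro i δ j δ'
    rw [norm_mul]
    nlinarith [hge i δ, hge j δ']
  have hmul1 : ∀ i δ j δ', p i δ * p j δ' ≠ 1 := by
    intro i δ j δ' h
    have := hmul i δ j δ'
    rw [h, norm_one] at this
    exact lt_irrefl _ this
  have hdist : ∀ (i : Fin n) δ (j : Fin n) δ', e i δ ≠ e j δ' → p i δ ≠ p j δ' := by
    intro i δ j δ' hij h
    have h1 := hnorm i δ
    rw [h, hnorm] at h1
    have h2 := mul_left_cancel₀ (by linarith) h1
    exact hij (pow_right_injective₀ (by norm_num) (by norm_num) h2).symm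
  refine ⟨p, fun i h => ?_, fun ε => ⟨fun i => ⟨hne0 _ _, ?_, ?_, ?_⟩, fun i j hij => ⟨?_, hmul1 _ _ _ _⟩⟩⟩
  · have h1 := hne0 i false
    have h2 := hne0 i true
    have h3 : (p i false - p i true) * (p i false * p i true - 1) = 0 := by
      field_simp at h
      linear_combination h
    rcases mul_eq_zero.1 h3 with h3 | h3
    · exact hdist i false i true (by simp [e]) (sub_eq_zero.1 h3)
    · exact hmul1 _ _ _ _ (sub_eq_zero.1 h3)
  · rw [sq]; exact hmul1 _ _ _ _
  · intro h
    have h1 := congrArg norm h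
    rw [norm_mul, sq, norm_mul, norm_one] at h1
    have h2 : 1 < ‖q‖ * ρ := by
      rw [hρ, mul_add, mul_inv_cancel₀ hq.ne']; linarith
    have h3 := hge i (ε i)
    nlinarith [mul_le_mul h3 h3 (by linarith) (norm_nonneg _)]
  · intro h
    have h1 := hmul i (ε i) i (ε i)
    rw [← sq, h] at h1
    linarith
  · refine hdist _ _ _ _ fun h => hij (Fin.ext ?_)
    simp only [e] at h
    rcases h1 : ε i <;> rcases h2 : ε j <;> simp [h1, h2] at h <;> omega

theorem eq_zero_of_sum_elem_symmCoord_eq_zero {n : ℕ} {q : ℂ} (hq0 : q ≠ 0) (hq1 : ‖q‖ < 1)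
    (r : ℕ) (hr : r ≤ n + 1) (w : ℕ → ℂ) (h : ∀ x : Fin n → ℂ, IsRegularPoint q x →
      ∑ s ∈ Finset.range r, w s * elem (symmCoord x) s = 0) : ∀ s < r, w s = 0 := by
  obtain ⟨p, hp1, hp2⟩ := exists_regular_family n hq0 hq1
  intro s hs
  have := eq_zero_of_sum_elem_eq_zero (fun i δ => p i δ + (p i δ)⁻¹) hp1
    (fun s => if s < r then w s else 0) (fun ε => by
      have h1 := h _ (hp2 ε)
      rw [← Finset.sum_subset (Finset.range_mono hr) (fun s _ hs => by
        rw [Finset.mem_range] at hs; rw [if_neg hs, zero_mul]), ← h1]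
      exact Finset.sum_congr rfl fun s hs => by rw [if_pos (Finset.mem_range.1 hs)]; rfl)
    s (by omega)
  simpa [hs] using this

end Independence

/-! ### Kernel coefficients as Laurent polynomials -/

section Column

variable {n : ℕ} (β γ : ℕ → ℂ)

/-- The symmetric Laurent polynomials dual to `orthPoly β γ (n - r)`. -/
noncomputable def columnPoly (n r : ℕ) : Laurent n :=
  ∑ s ∈ Finset.range (n + 1),
    ((-1) ^ (r + s) * connCoeff β γ (n - s) (n - r)) • monomialSymm (column n s)

theorem eval_columnPoly (r : ℕ) (x : Fin n → ℂ) :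
    (columnPoly β γ n r).eval x = (-1) ^ r * prodCoeff β γ (symmCoord x) (n - r) := by
  rw [columnPoly, Laurent.eval_sum, prodCoeff, Finset.mul_sum]
  refine Finset.sum_congr rfl fun s hs => ?_
  rw [Laurent.eval_smul, eval_monomialSymm_column s (by simpa [Nat.lt_succ_iff] using hs), pow_add]
  ring

/-- The coefficients of `columnPoly β γ n r` below the leading one. -/
noncomputable def columnCoeff (n r s : ℕ) : ℂ := (-1) ^ (r + s) * connCoeff β γ (n - s) (n - r)

theorem columnPoly_eq (r : ℕ) (hr : r ≤ n) : columnPoly β γ n r = monomialSymm (column n r) +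
    ∑ s ∈ Finset.range r, columnCoeff β γ n r s • monomialSymm (column n s) := by
  rw [columnPoly, ← Finset.sum_subset (Finset.range_mono (show r + 1 ≤ n + 1 by omega))
    (fun s h1 h2 => by
      simp only [Finset.mem_range] at h1 h2
      rw [connCoeff_eq_zero _ _ _ _ (by omega), mul_zero, zero_smul]), Finset.sum_range_succ,
    connCoeff_self, ← two_mul, pow_mul, neg_one_sq, one_pow, one_mul, one_smul, add_comm]
  rfl

theorem exists_sum_columnPoly (r : ℕ) (hr : r ≤ n + 1) (w : ℕ → ℂ) : ∃ u : ℕ → ℂ,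
    ∑ s ∈ Finset.range r, w s • monomialSymm (column n s) =
      ∑ s ∈ Finset.range r, u s • columnPoly β γ n s := by
  induction r generalizing w with
  | zero => exact ⟨w, by simp⟩
  | succ r ih =>
    obtain ⟨u, hu⟩ := ih (by omega) fun s => w s - w r * columnCoeff β γ n r s
    refine ⟨fun s => if s < r then u s else w r, ?_⟩
    rw [Finset.sum_range_succ, Finset.sum_range_succ]
    dsimp only
    rw [if_neg (lt_irrefl r), columnPoly_eq β γ r (by omega), smul_add, Finset.smul_sum]
    have h1 : ∑ s ∈ Finset.range r, (if s < r then u s else w r) • columnPoly β γ n s =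
        ∑ s ∈ Finset.range r, u s • columnPoly β γ n s :=
      Finset.sum_congr rfl fun s hs => by rw [if_pos (Finset.mem_range.1 hs)]
    rw [h1, ← hu]
    simp only [sub_smul, Finset.sum_sub_distrib, smul_smul]
    abel

/-- A unitriangular change of basis; the preserved top coefficient lets independence descend by
induction on r. -/
theorem exists_sum_elem (r : ℕ) (hr : r ≤ n + 1) (u : ℕ → ℂ) : ∃ w : ℕ → ℂ,
    (∀ x : Fin n → ℂ, ∑ s ∈ Finset.range r, u s * (columnPoly β γ n s).eval x =
      ∑ s ∈ Finset.range r, w s * elem (symmCoord x) s) ∧ w (r - 1) = u (r - 1) := by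
  induction r with
  | zero => exact ⟨u, by simp⟩
  | succ r ih =>
    obtain ⟨w, hw, -⟩ := ih (by omega)
    refine ⟨fun s => if s < r then w s + u r * columnCoeff β γ n r s else u r, fun x => ?_,
      by simp⟩
    rw [Finset.sum_range_succ, Finset.sum_range_succ]
    dsimp only
    rw [if_neg (lt_irrefl r), hw, columnPoly_eq β γ r (by omega), Laurent.eval_add,
      Laurent.eval_sum, eval_monomialSymm_column r (by omega), mul_add, Finset.mul_sum,
      add_comm (u r * _), ← add_assoc, ← Finset.sum_add_distrib]
    congr 1
    refine Finset.sum_congr rfl fun s hs => ?_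
    rw [Finset.mem_range] at hs
    rw [if_pos hs, Laurent.eval_smul, eval_monomialSymm_column s (by omega)]
    ring

theorem eq_zero_of_sum_columnPoly_eq_zero {q : ℂ} (hq0 : q ≠ 0) (hq1 : ‖q‖ < 1)
    (r : ℕ) (hr : r ≤ n + 1) (u : ℕ → ℂ) (h : ∀ x : Fin n → ℂ, IsRegularPoint q x →
      ∑ s ∈ Finset.range r, u s * (columnPoly β γ n s).eval x = 0) : ∀ s < r, u s = 0 := by
  induction r with
  | zero => intro s hs; omega
  | succ r ih =>
    obtain ⟨w, hw, hwr⟩ := exists_sum_elem (n := n) β γ (r + 1) hr u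
    have hur : u r = 0 := by
      rw [Nat.add_sub_cancel] at hwr
      rw [← hwr]
      exact eq_zero_of_sum_elem_symmCoord_eq_zero hq0 hq1 (r + 1) hr w
        (fun x hx => by rw [← hw, h x hx]) r (by omega)
    intro s hs
    rcases Nat.lt_succ_iff_lt_or_eq.1 hs with hs | rfl
    · refine ih (by omega) (fun x hx => ?_) s hs
      have h1 := h x hx
      rwa [Finset.sum_range_succ, hur, zero_mul, add_zero] at h1
    · exact hur

end Column

/-! ### Existence, uniqueness and the branching rule -/

section Main

variable {m n : ℕ} {a b c d q t : ℂ}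

theorem isKoornwinder_columnPoly (h : Generic m a b c d t) (hn : n ≤ m) (hq : q ≠ 0)
    (hB : a * b * c * d / q ≠ 0) (r : ℕ) (hr : r ≤ n) :
    IsKoornwinder a b c d q t (column n r)
      (columnPoly (gSeq a b c d t) (fSeq a b c d t) n r) where
  triangular := by
    rw [triangular_iff r hr]
    exact ⟨_, by rw [columnPoly_eq _ _ r hr, add_sub_cancel_left]⟩
  eigen x hx := by
    rw [eigenvalue_column hB hq h.t_ne r hr, funext (eval_columnPoly (n := n) _ _ r),
      koornwinderOp_const_mul,
      koornwinderOp_prodCoeff h hn hq (alpha_ne_zero hB) hx (n - r) (Nat.sub_le _ _)]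
    ring

theorem eigenvalue_column_ne (h : Generic m a b c d t) (hn : n ≤ m) (hq : q ≠ 0)
    (hq1 : ‖q‖ < 1) (hB : a * b * c * d / q ≠ 0) {r s : ℕ} (hr : r ≤ n) (hs : s < r) :
    eigenvalue a b c d q t (column n s) ≠ eigenvalue a b c d q t (column n r) := by
  intro he
  rw [eigenvalue_column hB hq h.t_ne r hr, eigenvalue_column hB hq h.t_ne s (hs.le.trans hr)] at he
  have h1 : 1 - q ≠ 0 := by
    intro h0
    rw [← sub_eq_zero.1 h0, norm_one] at hq1
    exact lt_irrefl _ hq1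
  have hα := alpha_ne_zero hB
  have h2 := mul_left_cancel₀ (by positivity) he
  have h3 := h.awEigen_sub_ne (n - r) (r - s) (by omega) (by omega)
  rw [show n - r + (r - s) = n - s by omega] at h3
  exact h3 (by linear_combination -h2)

/-- The difference of P and the kernel coefficient is a combination of those for smaller columns.
Applying the operator multiplies each coefficient by a nonzero eigenvalue difference, so
independence makes all of them vanish. -/
theorem IsKoornwinder.eq_columnPoly (h : Generic m a b c d t) (hn : n ≤ m) (hq : q ≠ 0)
    (hq1 : ‖q‖ < 1) (hB : a * b * c * d / q ≠ 0) {r : ℕ} (hr : r ≤ n) {P : Laurent n}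
    (hP : IsKoornwinder a b c d q t (column n r) P) :
    P = columnPoly (gSeq a b c d t) (fSeq a b c d t) n r := by
  set β := gSeq a b c d t
  set γ := fSeq a b c d t
  have hQ := isKoornwinder_columnPoly h hn hq hB r hr
  have hR : ∃ w : ℕ → ℂ, P - columnPoly β γ n r =
      ∑ s ∈ Finset.range r, w s • monomialSymm (column n s) := by
    rw [← triangular_iff r hr]
    have := Submodule.sub_mem _ hP.triangular hQ.triangular
    rwa [sub_sub_sub_cancel_right] at this
  obtain ⟨w, hw⟩ := hR
  obtain ⟨u, hu⟩ := exists_sum_columnPoly (n := n) β γ r (by omega) w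
  rw [hu, sub_eq_iff_eq_add] at hw
  have hPe : ∀ x, P.eval x = ∑ s ∈ Finset.range r, u s * (columnPoly β γ n s).eval x +
      1 * (columnPoly β γ n r).eval x := by
    intro x
    rw [hw, Laurent.eval_add, Laurent.eval_sum, one_mul]
    simp only [Laurent.eval_smul]
  have hz := eq_zero_of_sum_columnPoly_eq_zero (n := n) β γ hq hq1 r (by omega)
    (fun s => u s * (eigenvalue a b c d q t (column n s) - eigenvalue a b c d q t (column n r)))
    (fun x hx => by
      have h1 := hP.eigen x hx
      have h2 : P.eval = fun x => ∑ s ∈ Finset.range (r + 1),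
          (if s < r then u s else 1) * (columnPoly β γ n s).eval x := by
        funext x
        rw [hPe, Finset.sum_range_succ, if_neg (lt_irrefl r)]
        congr 1
        exact Finset.sum_congr rfl fun s hs => by rw [if_pos (Finset.mem_range.1 hs)]
      rw [h2, koornwinderOp_sum, Finset.mul_sum, ← sub_eq_zero, ← Finset.sum_sub_distrib] at h1
      rw [Finset.sum_range_succ, hQ.eigen x hx, if_neg (lt_irrefl r)] at h1
      rw [← h1, eq_comm, mul_left_comm, sub_self, add_zero]
      refine Finset.sum_congr rfl fun s hs => ?_
      rw [Finset.mem_range] at hs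
      rw [(isKoornwinder_columnPoly h hn hq hB s (hs.le.trans hr)).eigen x hx, if_pos hs]
      ring)
  have hu0 : ∀ s < r, u s = 0 := fun s hs =>
    (mul_eq_zero.1 (hz s hs)).resolve_right
      (sub_ne_zero.2 (eigenvalue_column_ne h hn hq hq1 hB hr hs))
  rw [hw, Finset.sum_eq_zero fun s hs => by rw [hu0 s (Finset.mem_range.1 hs), zero_smul],
    zero_add]

theorem eval_koornwinderColumn (h : Generic m a b c d t) (hn : n ≤ m) (hq : q ≠ 0)
    (hq1 : ‖q‖ < 1) (hB : a * b * c * d / q ≠ 0) {r : ℕ} (hr : r ≤ n) (x : Fin n → ℂ) :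
    (koornwinderColumn n a b c d q t r).eval x =
      (-1) ^ r * prodCoeff (gSeq a b c d t) (fSeq a b c d t) (symmCoord x) (n - r) := by
  have hex : ∃ P, IsKoornwinder a b c d q t (column n r) P :=
    ⟨_, isKoornwinder_columnPoly h hn hq hB r hr⟩
  rw [koornwinderColumn, if_pos ⟨by omega, by exact_mod_cast hr⟩, Int.toNat_natCast, koornwinder,
    dif_pos hex, hex.choose_spec.eq_columnPoly h hn hq hq1 hB hr, eval_columnPoly]

theorem eval_koornwinderColumn_eq_zero {r : ℤ} (h : ¬(0 ≤ r ∧ r ≤ n)) (x : Fin n → ℂ) :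
    (koornwinderColumn n a b c d q t r).eval x = 0 := by
  rw [koornwinderColumn, if_neg h]
  exact map_zero (Laurent.evalₗ x)

theorem eval_koornwinderColumn_pred (h : Generic m a b c d t) (hn : n ≤ m) (hq : q ≠ 0)
    (hq1 : ‖q‖ < 1) (hB : a * b * c * d / q ≠ 0) {r : ℕ} (hr : r ≤ n) (x : Fin n → ℂ) :
    (koornwinderColumn n a b c d q t ((r : ℤ) - 1)).eval x =
      (-1) ^ (r + 1) *
        prodCoeff (gSeq a b c d t) (fSeq a b c d t) (symmCoord x) (n - r + 1) := by
  cases r with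
  | zero =>
    -- The convention P = 0 for r = -1 matches the vanishing kernel coefficient of index n + 1.
    rw [eval_koornwinderColumn_eq_zero (by simp), prodCoeff_eq_zero _ _ _ _ (by omega), mul_zero]
  | succ r =>
    rw [Nat.cast_succ, add_sub_cancel_right,
      eval_koornwinderColumn h hn hq hq1 hB (by omega : r ≤ n),
      show n - (r + 1) + 1 = n - r by omega, pow_add _ (r + 1) 1, pow_add]
    ring

theorem branching_rule (h : Generic (m + 1) a b c d t) (hq : q ≠ 0) (hq1 : ‖q‖ < 1)
    (hB : a * b * c * d / q ≠ 0) (r : ℕ) (hr : r ≤ m + 1) (x : Fin (m + 1) → ℂ) :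
    (koornwinderColumn (m + 1) a b c d q t r).eval x =
      (koornwinderColumn m a b c d q t r).eval (Fin.init x) +
        (x (Fin.last m) + 1 / x (Fin.last m) + g a b c d t (t ^ (m + 1 - r))) *
          (koornwinderColumn m a b c d q t (r - 1)).eval (Fin.init x) +
        f a b c d t (t ^ (m + 1 - r)) *
          (koornwinderColumn m a b c d q t (r - 2)).eval (Fin.init x) := by
  have hm : m ≤ m + 1 := Nat.le_succ m
  have hs : Fin.init (symmCoord x) = symmCoord (Fin.init x) := rfl
  rw [eval_koornwinderColumn h le_rfl hq hq1 hB hr]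
  cases r with
  | zero =>
    rw [eval_koornwinderColumn h hm hq hq1 hB (Nat.zero_le m),
      eval_koornwinderColumn_eq_zero (by simp), eval_koornwinderColumn_eq_zero (by simp)]
    simp [prodCoeff_self]
  | succ r =>
    have hl : symmCoord x (Fin.last m) = x (Fin.last m) + 1 / x (Fin.last m) := by
      rw [one_div]; rfl
    rw [show ((r + 1 : ℕ) : ℤ) - 1 = r by push_cast; ring,
      show ((r + 1 : ℕ) : ℤ) - 2 = (r : ℤ) - 1 by push_cast; ring,
      eval_koornwinderColumn h hm hq hq1 hB (by omega : r ≤ m),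
      eval_koornwinderColumn_pred h hm hq hq1 hB (by omega : r ≤ m),
      show m + 1 - (r + 1) = m - r by omega, ← hl]
    -- The full column corresponds to kernel index 0, where the recursion has no preceding term;
    -- correspondingly the column of length m + 1 in m variables is zero.
    rcases (show r ≤ m by omega).lt_or_eq with hlt | rfl
    · obtain ⟨k, hk⟩ : ∃ k, m - r = k + 1 := ⟨m - r - 1, by omega⟩
      rw [eval_koornwinderColumn h hm hq hq1 hB (by omega : r + 1 ≤ m), hk,
        show m - (r + 1) = k by omega, prodCoeff_succ_succ, hs, gSeq, fSeq]
      ring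
    · rw [eval_koornwinderColumn_eq_zero (by push_cast; omega), Nat.sub_self, prodCoeff_succ_zero,
        hs, gSeq, fSeq]
      ring

end Main

end Koornwinder

theorem theorem1p3 (m : ℕ) (a b c d q t : ℂ)
    (ha : a ≠ 0) (hb : b ≠ 0) (hc : c ≠ 0) (hd : d ≠ 0)
    (hq0 : q ≠ 0) (hq1 : ‖q‖ < 1) (ht0 : t ≠ 0)
    (ht : ∀ k : ℕ, 1 ≤ k → k ≤ m + 1 → t ^ k ≠ 1)
    (habcd : ∀ k : ℤ, -2 ≤ k → k ≤ 2 * m → a * b * c * d * t ^ k ≠ 1) :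
    (∀ n r : ℕ, n ≤ m + 1 → r ≤ n →
      ∃! P : Koornwinder.Laurent n,
        Koornwinder.IsKoornwinder a b c d q t (Koornwinder.column n r) P) ∧
    ∀ r : ℕ, r ≤ m + 1 → ∀ x : Fin (m + 1) → ℂ, (∀ i, x i ≠ 0) →
      (Koornwinder.koornwinderColumn (m + 1) a b c d q t r).eval x =
        (Koornwinder.koornwinderColumn m a b c d q t r).eval (Fin.init x) +
        (x (Fin.last m) + 1 / x (Fin.last m) +
            Koornwinder.g a b c d t (t ^ (m + 1 - r))) *
          (Koornwinder.koornwinderColumn m a b c d q t (r - 1)).eval (Fin.init x) +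
        Koornwinder.f a b c d t (t ^ (m + 1 - r)) *
          (Koornwinder.koornwinderColumn m a b c d q t (r - 2)).eval (Fin.init x) := by
  have h : Koornwinder.Generic (m + 1) a b c d t :=
    ⟨ha, ht0, ht, fun k h1 h2 => habcd k h1 (by push_cast at h2; omega)⟩
  have hB : a * b * c * d / q ≠ 0 := by positivity
  exact ⟨fun n r hn hr => ⟨_, Koornwinder.isKoornwinder_columnPoly h hn hq0 hB r hr,
    fun P hP => hP.eq_columnPoly h hn hq0 hq1 hB hr⟩,
    fun r hr x _ => Koornwinder.branching_rule h hq0 hq1 hB r hr x⟩
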